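/- Work on $\mathbb R^{1+2}=\mathbb R_t\times\mathbb R^2_x$, with space-time Fourier transform $\tilde u(\tau,\xi)=\int e^{-i(t\tau+x\cdot\xi)}u(t,x)\,dt\,dx$ and $\langle a\rangle=(1+|a|^2)^{1/2}$. Let $1<r\le 2$, $\frac1r+\frac1{r'}=1$. For $s,b\in\mathbb R$ and a sign $\pm$, the spaces $X^r_{s,b,\pm}$ and $H^r_{s,b}$ are the completions of the Schwartz space $\mathcal S(\mathbb R^{1+2})$ with respect to the norms $$\|u\|_{X^r_{s,b,\pm}}=\|\langle\xi\rangle^s\langle\tau\pm|\xi|\rangle^b\,\tilde u(\tau,\xi)\|_{L^{r'}_{\tau\xi}},\qquad \|u\|_{H^r_{s,b}}=\|\langle\xi\rangle^s\langle|\tau|-|\xi|\rangle^b\,\tilde u(\tau,\xi)\|_{L^{r'}_{\tau\xi}} ;$$ via the Fourier transform, $X^r_{s,b,\pm}$ is the space of all measurable $\tilde u$ with finite norm. Let $|\nabla|$ and $|\nabla|^{-1}$ have the Fourier symbols $|\xi|$ and $|\xi|^{-1}$, and put $$q_{12}(u,v)=\partial_1|\nabla|^{-1}u\;\partial_2|\nabla|^{-1}v-\partial_2|\nabla|^{-1}u\;\partial_1|\nabla|^{-1}v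 .$$ For signs $\pm_1,\pm_2$ and $j\in\{1,2\}$ let $$q_{0j}(u,v)=\partial_0^{\pm_1}|\nabla|^{-1}u\;\partial_j|\nabla|^{-1}v-\partial_j|\nabla|^{-1}u\;\partial_0^{\pm_2}|\nabla|^{-1}v ,\qquad \partial_0^{\pm}:=\mp i|\nabla| ,$$ where $\partial_0^\pm$ is the operator by which $\partial_t$ acts on the half waves $e^{\mp it|\nabla|}f$ belonging to $X^r_{s,b,\pm}$ (on the cone $\tau\pm|\xi|=0$ the symbol $i\tau$ of $\partial_t$ is $\mp i|\xi|$). Let $\alpha_1,\alpha_2\ge 0$, $\alpha_1+\alpha_2\ge\frac1r$ and $b>\frac1r$. Then there is a constant $C$, depending only on $r,\alpha_1,\alpha_2,b$, such that for all choices of the signs $\pm_1,\pm_2$, for $q=q_{12}$, $q=q_{01}$ and $q=q_{02}$, and for all $u,v\in\mathcal S(\mathbb R^{1+2})$, the function $q(u,v)$ is integrable and $$\|q(u,v)\|_{H^r_{0,0}}\le C\,\|u\|_{X^r_{\alpha_1,b,\pm_1}}\|v\|_{X^r_{\alpha_2,b,\pm_2}} .\qquad(*)$$ Moreover, let $m(\eta,\zeta)$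 be the symbol of $q$, that is, $$\frac{(i\eta_1)(i\zeta_2)-(i\eta_2)(i\zeta_1)}{|\eta||\zeta|}\ \text{ for } q_{12},\qquad \frac{(\mp_1 i|\eta|)(i\zeta_j)-(i\eta_j)(\mp_2 i|\zeta|)}{|\eta||\zeta|}\ \text{ for } q_{0j} .$$ Then $$\widetilde{q(u,v)}(\tau,\xi)=(2\pi)^{-3}\int m(\eta,\xi-\eta)\,\tilde u(\lambda,\eta)\,\tilde v(\tau-\lambda,\xi-\eta)\,d\lambda\,d\eta\qquad(**)$$ for Schwartz functions $u,v$. For all $u\in X^r_{\alpha_1,b,\pm_1}$ and $v\in X^r_{\alpha_2,b,\pm_2}$ the integral in $(**)$ converges absolutely for almost every $(\tau,\xi)$, and $(*)$ holds for the extension of $q$ that is defined by $(**)$. -/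

import Mathlib

open MeasureTheory
open scoped FourierTransform SchwartzMap ENNReal NNReal

noncomputable section

namespace NullForms

/-- Space-time `ℝ^{1+2}` (and its dual, the space-time frequencies): coordinate `0` is the time `t`
(the frequency `τ`), coordinates `1, 2` are the space variable `x` (the frequency `ξ`). -/
abbrev SpaceTime : Type := EuclideanSpace ℝ (Fin 3)

/-- The Euclidean length `|ξ|` of the spatial part of `p = (τ, ξ)`. -/
def spNorm (p : SpaceTime) : ℝ := Real.sqrt (p 1 ^ 2 + p 2 ^ 2)

/-- The bracket `⟨a⟩ = (1 + a²)^{1/2}`. -/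
def bracket (a : ℝ) : ℝ := Real.sqrt (1 + a ^ 2)

/-- The dual exponent `r' = r / (r - 1)` of `r`. -/
def dualExp (r : ℝ) : ℝ≥0∞ := ENNReal.ofReal (r / (r - 1))

/-- A sign `±` as a real number `±1`. -/
def sgn (σ : ℤˣ) : ℝ := ((σ : ℤ) : ℝ)

/-- The space-time Fourier transform `û(p) = ∫ e^{-i x·p} u(x) dx`
(Mathlib's `𝓕` has the kernel `e^{-2π i x·k}`). -/
def ft (u : SpaceTime → ℂ) (p : SpaceTime) : ℂ := 𝓕 u ((2 * Real.pi)⁻¹ • p)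

/-- The Fourier multiplier with symbol `m(p)`, where `p` is the frequency of `e^{i x·p}`. -/
def multiplier (m : SpaceTime → ℂ) (u : SpaceTime → ℂ) : SpaceTime → ℂ :=
  𝓕⁻ (fun k : SpaceTime => m ((2 * Real.pi) • k) * 𝓕 u k)

/-! ### Norms -/

/-- The weight `⟨ξ⟩^s ⟨τ ± |ξ|⟩^b`. -/
def xWeight (s b : ℝ) (σ : ℤˣ) (p : SpaceTime) : ℝ :=
  bracket (spNorm p) ^ s * bracket (p 0 + sgn σ * spNorm p) ^ b

/-- The weight `⟨ξ⟩^s ⟨|τ| - |ξ|⟩^b`. -/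
def hWeight (s b : ℝ) (p : SpaceTime) : ℝ :=
  bracket (spNorm p) ^ s * bracket (|p 0| - spNorm p) ^ b

/-- `F` is the Fourier transform of an element of `X^r_{s,b,±}`, that is,
`⟨ξ⟩^s ⟨τ ± |ξ|⟩^b F` is in `L^{r'}`. -/
def MemXHat (r s b : ℝ) (σ : ℤˣ) (F : SpaceTime → ℂ) : Prop :=
  MemLp (fun p => (xWeight s b σ p : ℂ) * F p) (dualExp r) volume

/-- The `X^r_{s,b,±}` norm of `u` in terms of the Fourier transform `F` of `u`. -/
def xHatNorm (r s b : ℝ) (σ : ℤˣ) (F : SpaceTime → ℂ) : ℝ≥0∞ :=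
  eLpNorm (fun p => (xWeight s b σ p : ℂ) * F p) (dualExp r) volume

/-- The `H^r_{s,b}` norm of `u` in terms of the Fourier transform `F` of `u`. -/
def hHatNorm (r s b : ℝ) (F : SpaceTime → ℂ) : ℝ≥0∞ :=
  eLpNorm (fun p => (hWeight s b p : ℂ) * F p) (dualExp r) volume

/-- `‖u‖_{X^r_{s,b,±}}`. -/
def xNorm (r s b : ℝ) (σ : ℤˣ) (u : SpaceTime → ℂ) : ℝ≥0∞ := xHatNorm r s b σ (ft u)

/-- `‖u‖_{H^r_{s,b}}`. -/
def hNorm (r s b : ℝ) (u : SpaceTime → ℂ) : ℝ≥0∞ := hHatNorm r s b (ft u)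

/-! ### The null forms on functions -/

/-- The partial derivative `∂_α`. -/
def pd (α : Fin 3) (f : SpaceTime → ℂ) (x : SpaceTime) : ℂ :=
  fderiv ℝ f x (EuclideanSpace.single α 1)

/-- `|∇|⁻¹ u`. -/
def invGrad (u : SpaceTime → ℂ) : SpaceTime → ℂ :=
  multiplier (fun p => ((spNorm p)⁻¹ : ℂ)) u

/-- `q_{12}(u, v) = Q_{12}(|∇|⁻¹ u, |∇|⁻¹ v)`, where `Q_{12}(U, V) = ∂₁U ∂₂V - ∂₂U ∂₁V`. -/
def q12 (u v : SpaceTime → ℂ) (x : SpaceTime) : ℂ :=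
  pd 1 (invGrad u) x * pd 2 (invGrad v) x - pd 2 (invGrad u) x * pd 1 (invGrad v) x

/-- The symbol `∓ i |ξ|` of the time derivative of half waves of sign `±`: these are the functions
`e^{∓ i t |∇|} f`, whose Fourier transform lives on the cone `τ ± |ξ| = 0` which is distinguished
in the norm of `X^r_{s,b,±}`; on this cone the symbol `i τ` of `∂_t` equals `∓ i |ξ|`. -/
def dtSymbol (σ : ℤˣ) (p : SpaceTime) : ℂ := -Complex.I * (sgn σ * spNorm p : ℝ)

/-- On the cone `τ ± |ξ| = 0` the symbol of `∂_0^±` is the symbol `i τ` of `∂_t`. -/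
theorem dtSymbol_of_cone (σ : ℤˣ) (p : SpaceTime) (hp : p 0 + sgn σ * spNorm p = 0) :
    dtSymbol σ p = Complex.I * (p 0 : ℂ) := by
  have h : p 0 = -(sgn σ * spNorm p) := by linarith
  rw [dtSymbol, h]
  push_cast
  ring

/-- `∂_0^± |∇|⁻¹ u`, where `∂_0^± = ∓ i |∇|` is the time derivative of half waves of sign `±`. -/
def dtInvGrad (σ : ℤˣ) (u : SpaceTime → ℂ) : SpaceTime → ℂ :=
  multiplier (fun p => dtSymbol σ p * ((spNorm p)⁻¹ : ℂ)) u

/-- `q_{0j}(u, v) = Q_{0j}(|∇|⁻¹ u, |∇|⁻¹ v)`, where `Q_{0j}(U, V) = ∂₀U ∂_jV - ∂_jU ∂₀V`,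
for components `u`, `v` of half-wave signs `±₁`, `±₂`: the time derivatives are `∂_0^{±₁}` on
`|∇|⁻¹ u` and `∂_0^{±₂}` on `|∇|⁻¹ v`. Here `j = 0, 1` in `Fin 2` is the space direction
`x_1, x_2`. -/
def q0 (σ₁ σ₂ : ℤˣ) (j : Fin 2) (u v : SpaceTime → ℂ) (x : SpaceTime) : ℂ :=
  dtInvGrad σ₁ u x * pd j.succ (invGrad v) x - pd j.succ (invGrad u) x * dtInvGrad σ₂ v x

/-! ### The null forms on the Fourier side -/

/-- The symbol of `q_{12}`: `((iη₁)(iζ₂) - (iη₂)(iζ₁)) / (|η| |ζ|)`. -/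
def q12Symbol (k l : SpaceTime) : ℂ :=
  ((Complex.I * k 1) * (Complex.I * l 2) - (Complex.I * k 2) * (Complex.I * l 1))
    / (spNorm k * spNorm l : ℝ)

/-- The symbol of `q_{0j}` for half-wave signs `±₁`, `±₂`:
`((∓₁ i|η|)(iζ_j) - (iη_j)(∓₂ i|ζ|)) / (|η| |ζ|)`. -/
def q0Symbol (σ₁ σ₂ : ℤˣ) (j : Fin 2) (k l : SpaceTime) : ℂ :=
  (dtSymbol σ₁ k * (Complex.I * l j.succ) - (Complex.I * k j.succ) * dtSymbol σ₂ l)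
    / (spNorm k * spNorm l : ℝ)

/-- The integrand of the bilinear multiplier with symbol `m` at the output frequency `p`. -/
def bilinIntegrand (m : SpaceTime → SpaceTime → ℂ) (F G : SpaceTime → ℂ) (p k : SpaceTime) : ℂ :=
  m k (p - k) * F k * G (p - k)

/-- The Fourier transform of the bilinear expression with symbol `m` in `u, v`, where `F = û` and
`G = v̂`; for `m = 1` this is the Fourier transform `(2π)^{-3} F * G` of the product `u v`. -/
def bilinHat (m : SpaceTime → SpaceTime → ℂ) (F G : SpaceTime → ℂ) (p : SpaceTime) : ℂ :=
  ((2 * Real.pi) ^ 3 : ℝ)⁻¹ * ∫ k : SpaceTime, bilinIntegrand m F G p k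

end NullForms

end

noncomputable section

namespace NullForms

/-! ### Polar coordinates in space -/

/-! Write κ for the product of the two signs. Hölder's inequality in the convolution variable, with
exponents r and r', followed by Tonelli, reduces the estimate to a bound, uniform in the output
frequency p, for the integral over k of the r-th power of the symbol divided by the two weights.

Both kinds of symbol satisfy |m|² ≤ 2D with D = 1 - κ cos∠(η, ξ-η) (`norm_q12Symbol_sq_le`,
`norm_q0Symbol_sq_le`). Since (α₁+α₂)r ≥ 1, the spatial weights are dominated by |η|⁻¹ + |ξ-η|⁻¹,
and by the symmetry k ↔ p-k it suffices to treat |η|⁻¹. In polar coordinates η = sω this factor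
cancels the Jacobian, and the shift a = τ + σ₁s leaves, for fixed a, a planar integral of Ψ(s +
κ|ξ-sω|) D^{r/2}.

The decisive fact is that D is exactly the s-derivative of s + κ|ξ-sω|. One factor D is spent on the
substitution t = s + κ|ξ-sω| (`lintegral_radial_le`); the remaining D^{-(2-r)/2} is at most 1 +
(ρ|sin θ|/|t - ρ cos θ|)^{2-r}, where ρ = |ξ| and θ is the angle between ω and ξ (`rpow_defect_le`).
For r > 1 the exponent 2-r is below 1, so the θ-integral of the singular term is bounded uniformly
in t and ρ (`exists_angular_bound`). What remains are two one-dimensional integrals of ⟨t⟩^{-br},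
finite because br > 1.

For Schwartz functions the formula with the physical-space definition must also be justified: the
symbols are bounded but discontinuous at ξ = 0, so the multiplied transforms are in L¹ ∩ L² without
being Schwartz, and the product formula is obtained from Plancherel (`fourier_fourierInv_mul`). -/

theorem measurePreserving_coords :
    MeasurePreserving (fun p : SpaceTime => (p 0, (p 1, p 2))) volume volume := by
  have h1 := PiLp.volume_preserving_ofLp (Fin 3)
  have h2 := volume_preserving_piFinSuccAbove (fun _ : Fin 3 => ℝ) 0
  have h3 := (MeasurePreserving.id (volume : Measure ℝ)).prod (volume_preserving_finTwoArrow ℝ)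
  exact (h3.comp h2).comp h1

theorem lintegral_coords {f : SpaceTime → ℝ≥0∞} (hf : Measurable f) :
    ∫⁻ p, f p = ∫⁻ τ : ℝ, ∫⁻ x : ℝ × ℝ, f !₂[τ, x.1, x.2] := by
  have hm : Measurable (fun x : ℝ × ℝ × ℝ => (!₂[x.1, x.2.1, x.2.2] : SpaceTime)) :=
    Continuous.measurable (by fun_prop)
  have h := measurePreserving_coords.lintegral_comp (hf.comp hm)
  have h0 : ∀ p : SpaceTime, (!₂[p 0, p 1, p 2] : SpaceTime) = p := by
    intro p; ext i; fin_cases i <;> rfl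
  simp only [Function.comp_apply, h0] at h
  rw [h]
  exact lintegral_prod _ (hf.comp hm).aemeasurable

theorem lintegral_polar {f : SpaceTime → ℝ≥0∞} (hf : Measurable f) :
    ∫⁻ p, f p = ∫⁻ τ : ℝ, ∫⁻ θ in Set.Ioc (-Real.pi) Real.pi, ∫⁻ s in Set.Ioi (0 : ℝ),
      ENNReal.ofReal s * f !₂[τ, s * Real.cos θ, s * Real.sin θ] := by
  rw [lintegral_coords hf]
  congr 1; ext τ
  rw [← lintegral_comp_polarCoord_symm, polarCoord_target, Measure.volume_eq_prod,
    ← Measure.prod_restrict]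
  have hm : Measurable (fun x : ℝ × ℝ =>
      ENNReal.ofReal x.1 • f !₂[τ, x.1 * Real.cos x.2, x.1 * Real.sin x.2]) := by
    refine (ENNReal.measurable_ofReal.comp measurable_fst).mul (hf.comp ?_)
    exact Continuous.measurable (by fun_prop)
  simp only [polarCoord_symm_apply]
  -- The half-open interval differs by a null set and is a fundamental domain for translation by 2π,
  -- which later makes angular shifts harmless.
  rw [lintegral_prod_symm' _ hm, restrict_Ioo_eq_restrict_Ioc]
  rfl

/-! ### An angular integral -/

/-- `|cot (θ/2)|` -/
def cotHalf (θ : ℝ) : ℝ := |Real.cos (θ / 2) / Real.sin (θ / 2)|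

theorem cotHalf_nonneg (θ : ℝ) : 0 ≤ cotHalf θ := abs_nonneg _

theorem measurable_cotHalf : Measurable cotHalf := by unfold cotHalf; fun_prop

theorem cotHalf_periodic : Function.Periodic cotHalf (2 * Real.pi) := by
  intro θ
  have : (θ + 2 * Real.pi) / 2 = θ / 2 + Real.pi := by ring
  simp [cotHalf, this, Real.cos_add_pi, Real.sin_add_pi]

theorem setLIntegral_Ioc_comp_add {f : ℝ → ℝ≥0∞} (hf : Function.Periodic f (2 * Real.pi))
    (a : ℝ) :
    ∫⁻ θ in Set.Ioc (-Real.pi) Real.pi, f (θ + a) = ∫⁻ θ in Set.Ioc (-Real.pi) Real.pi, f θ := by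
  have hmp : MeasurePreserving (fun θ : ℝ => θ + a) volume volume :=
    measurePreserving_add_right volume a
  have h1 := hmp.setLIntegral_comp_emb (MeasurableEquiv.addRight a).measurableEmbedding f
    (Set.Ioc (-Real.pi) Real.pi)
  rw [h1, Set.image_add_const_Ioc]
  have h2 : Real.pi + a = (-Real.pi + a) + 2 * Real.pi := by ring
  have h3 : (Set.Ioc (-Real.pi) Real.pi) = Set.Ioc (-Real.pi) (-Real.pi + 2 * Real.pi) := by
    congr 1; ring
  rw [h2, h3]
  refine (isAddFundamentalDomain_Ioc Real.two_pi_pos _).setLIntegral_eq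
    (isAddFundamentalDomain_Ioc Real.two_pi_pos _) f ?_
  rintro ⟨g, hg⟩ x
  obtain ⟨n, rfl⟩ := AddSubgroup.mem_zmultiples_iff.1 hg
  simpa [AddSubgroup.vadd_def, add_comm] using hf.zsmul n x

/-- With t = cos a, sin θ / (cos a - cos θ) is half the sum of cot((θ-a)/2) and cot((θ+a)/2). For t
outside [-1, 1], `Real.arccos` clamps to 0 or π, which only decreases the distance to cos θ. -/
theorem abs_sin_div_le (t θ : ℝ) :
    |Real.sin θ| / |t - Real.cos θ| ≤
      (cotHalf (θ + -Real.arccos t) + cotHalf (θ + Real.arccos t)) := by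
  set a := Real.arccos t with ha
  have hc := cotHalf_nonneg (θ + -a)
  have hc' := cotHalf_nonneg (θ + a)
  rcases eq_or_ne (t - Real.cos θ) 0 with h0 | h0
  · simp only [h0, abs_zero, div_zero]; positivity
  rcases eq_or_ne (Real.sin θ) 0 with hs | hs
  · simp only [hs, abs_zero, zero_div]; positivity
  have hlt : |Real.cos θ| < 1 := by
    rw [← sq_lt_one_iff_abs_lt_one]; have := Real.sin_sq_add_cos_sq θ
    have : 0 < Real.sin θ ^ 2 := by positivity
    linarith
  rw [abs_lt] at hlt
  have hac : Real.cos a - Real.cos θ ≠ 0 ∧ |Real.cos a - Real.cos θ| ≤ |t - Real.cos θ| := by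
    rcases le_total 1 t with h1 | h1
    · rw [ha, Real.arccos_eq_zero.2 h1, Real.cos_zero]
      exact ⟨by linarith, by rw [abs_of_pos (by linarith), abs_of_pos (by linarith)]; linarith⟩
    · rcases le_total t (-1) with h2 | h2
      · rw [ha, Real.arccos_eq_pi.2 h2, Real.cos_pi]
        exact ⟨by linarith, by rw [abs_of_neg (by linarith), abs_of_neg (by linarith)]; linarith⟩
      · rw [ha, Real.cos_arccos h2 h1]; exact ⟨h0, le_rfl⟩
  have hid : Real.cos a - Real.cos θ =
      2 * Real.sin ((θ + a) / 2) * Real.sin ((θ + -a) / 2) := by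
    rw [Real.cos_sub_cos, show (a - θ) / 2 = -((θ + -a) / 2) by ring, Real.sin_neg, add_comm a]
    ring
  have hsum : Real.sin θ = Real.sin ((θ + -a) / 2) * Real.cos ((θ + a) / 2) +
      Real.cos ((θ + -a) / 2) * Real.sin ((θ + a) / 2) := by
    rw [← Real.sin_add]; congr 1; ring
  have hne := hac.1
  rw [hid] at hne
  have hA : Real.sin ((θ + a) / 2) ≠ 0 := by intro h; simp [h] at hne
  have hB : Real.sin ((θ + -a) / 2) ≠ 0 := by intro h; simp [h] at hne
  calc |Real.sin θ| / |t - Real.cos θ| ≤ |Real.sin θ| / |Real.cos a - Real.cos θ| :=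
        div_le_div_of_nonneg_left (abs_nonneg _) (abs_pos.2 hac.1) hac.2
    _ = |(Real.cos ((θ + -a) / 2) / Real.sin ((θ + -a) / 2) +
          Real.cos ((θ + a) / 2) / Real.sin ((θ + a) / 2)) / 2| := by
        rw [← abs_div, hid, hsum]; congr 1; field_simp; ring
    _ ≤ (cotHalf (θ + -a) + cotHalf (θ + a)) / 2 := by
        rw [abs_div, abs_two]; gcongr; exact abs_add_le _ _
    _ ≤ _ := by linarith

/-- Jordan's inequality gives |cot(θ/2)| ≤ π/|θ|, and |θ|^{-γ} is integrable at 0 exactly because γ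
< 1. -/
theorem lintegral_cotHalf_rpow_lt_top {γ : ℝ} (h0 : 0 ≤ γ) (h1 : γ < 1) :
    ∫⁻ θ in Set.Ioc (-Real.pi) Real.pi, ENNReal.ofReal (cotHalf θ ^ γ) < ∞ := by
  have hint : IntegrableOn (fun θ : ℝ => Real.pi ^ γ * (|θ| ^ (-γ))) (Set.Ioc (-Real.pi) Real.pi) := by
    refine Integrable.const_mul ?_ _
    have hr : IntegrableOn (fun θ : ℝ => |θ| ^ (-γ)) (Set.Ioc 0 Real.pi) := by
      refine (((intervalIntegrable_iff_integrableOn_Ioc_of_le Real.pi_pos.le).1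
        (intervalIntegral.intervalIntegrable_rpow' (r := -γ) (by linarith)))).congr_fun ?_
        measurableSet_Ioc
      intro θ hθ
      simp only [abs_of_pos hθ.1]
    have hl : IntegrableOn (fun θ : ℝ => |θ| ^ (-γ)) (Set.Icc (-Real.pi) 0) := by
      have := (integrableOn_Icc_iff_integrableOn_Ioc (by simp)).2 hr
      have h2 := ((Measure.measurePreserving_neg (volume : Measure ℝ)).integrableOn_comp_preimage
        (MeasurableEquiv.neg ℝ).measurableEmbedding).2 this
      rw [show Neg.neg ⁻¹' Set.Icc 0 Real.pi = Set.Icc (-Real.pi) 0 by simp] at h2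
      exact h2.congr_fun (fun x _ => by simp) measurableSet_Icc
    exact (hl.union hr).mono_set (by
      intro x hx
      rcases le_or_gt x 0 with h | h
      · exact Or.inl ⟨hx.1.le, h⟩
      · exact Or.inr ⟨h, hx.2⟩)
  refine lt_of_le_of_lt (setLIntegral_mono' measurableSet_Ioc ?_) hint.lintegral_lt_top
  intro θ hθ
  refine ENNReal.ofReal_le_ofReal ?_
  have hle : cotHalf θ ≤ Real.pi / |θ| := by
    rcases eq_or_ne θ 0 with rfl | hne
    · simp [cotHalf]
    have hs : |θ| / Real.pi ≤ |Real.sin (θ / 2)| := by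
      have := Real.mul_abs_le_abs_sin (x := θ / 2) (by
        rw [abs_div, abs_two]; have := abs_le.2 ⟨hθ.1.le, hθ.2⟩; linarith)
      rw [abs_div, abs_two] at this
      calc _ = 2 / Real.pi * (|θ| / 2) := by ring
        _ ≤ _ := this
    rw [cotHalf, abs_div]
    have hp : 0 < |θ| := abs_pos.2 hne
    calc _ ≤ 1 / (|θ| / Real.pi) :=
          div_le_div₀ zero_le_one (Real.abs_cos_le_one _) (by positivity) hs
      _ = _ := by rw [one_div_div]
  calc cotHalf θ ^ γ ≤ (Real.pi / |θ|) ^ γ := Real.rpow_le_rpow (cotHalf_nonneg _) hle h0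
    _ = _ := by
      rw [Real.div_rpow Real.pi_pos.le (abs_nonneg _), Real.rpow_neg (abs_nonneg _)]; rfl

/-- Dividing by ρ removes the scale. Subadditivity of x ↦ x^γ separates the two cotangents, and
periodicity removes their shifts, which are the only remaining dependence on t, ρ and θ₀. -/
theorem exists_angular_bound {γ : ℝ} (h0 : 0 ≤ γ) (h1 : γ < 1) :
    ∃ B : ℝ≥0∞, B ≠ ∞ ∧ ∀ ρ : ℝ, 0 < ρ → ∀ t θ₀ : ℝ,
      ∫⁻ θ in Set.Ioc (-Real.pi) Real.pi,
        ENNReal.ofReal ((ρ * |Real.sin (θ + θ₀)| / |t - ρ * Real.cos (θ + θ₀)|) ^ γ) ≤ B := by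
  set A := ∫⁻ θ in Set.Ioc (-Real.pi) Real.pi, ENNReal.ofReal (cotHalf θ ^ γ) with hA
  have hAt : A ≠ ∞ := (lintegral_cotHalf_rpow_lt_top h0 h1).ne
  refine ⟨A + A, ENNReal.add_ne_top.2 ⟨hAt, hAt⟩, fun ρ hρ t θ₀ => ?_⟩
  have hper : Function.Periodic (fun θ => ENNReal.ofReal (cotHalf θ ^ γ)) (2 * Real.pi) :=
    fun θ => by simp only [cotHalf_periodic θ]
  have hshift := setLIntegral_Ioc_comp_add hper
  set a := Real.arccos (t / ρ) with ha
  calc _ ≤ ∫⁻ θ in Set.Ioc (-Real.pi) Real.pi,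
        (ENNReal.ofReal (cotHalf (θ + (θ₀ + -a)) ^ γ) +
          ENNReal.ofReal (cotHalf (θ + (θ₀ + a)) ^ γ)) := by
        refine lintegral_mono fun θ => ?_
        rw [← ENNReal.ofReal_add (Real.rpow_nonneg (cotHalf_nonneg _) _)
          (Real.rpow_nonneg (cotHalf_nonneg _) _)]
        refine ENNReal.ofReal_le_ofReal (le_trans ?_
          (Real.rpow_add_le_add_rpow (cotHalf_nonneg _) (cotHalf_nonneg _) h0 h1.le))
        refine Real.rpow_le_rpow (by positivity) ?_ h0
        have := abs_sin_div_le (t / ρ) (θ + θ₀)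
        rw [← ha] at this
        rw [← add_assoc, ← add_assoc]
        refine le_trans (le_of_eq ?_) this
        rw [show t - ρ * Real.cos (θ + θ₀) = ρ * (t / ρ - Real.cos (θ + θ₀)) by field_simp,
          abs_mul, abs_of_pos hρ, mul_div_mul_left _ _ hρ.ne']
    _ = A + A := by
        rw [lintegral_add_left]
        · rw [hshift, hshift]
        · exact ENNReal.measurable_ofReal.comp
            ((measurable_cotHalf.comp (measurable_id.add_const _)).pow_const _)

/-! ### The kernel bound -/

/-- `1 - κ cos ∠(k, l)` for the angle between the spatial parts of `k` and `l`. -/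
def angDefect (κ : ℝ) (k l : SpaceTime) : ℝ :=
  1 - κ * ((k 1 * l 1 + k 2 * l 2) / (spNorm k * spNorm l))

theorem continuous_spNorm : Continuous spNorm := by unfold spNorm; fun_prop

@[fun_prop]
theorem measurable_spNorm : Measurable spNorm := continuous_spNorm.measurable

theorem spNorm_nonneg (p : SpaceTime) : 0 ≤ spNorm p := Real.sqrt_nonneg _

theorem spNorm_sq (p : SpaceTime) : spNorm p ^ 2 = p 1 ^ 2 + p 2 ^ 2 :=
  Real.sq_sqrt (by positivity)

theorem spNorm_polar (τ θ : ℝ) {s : ℝ} (hs : 0 ≤ s) :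
    spNorm !₂[τ, s * Real.cos θ, s * Real.sin θ] = s := by
  change Real.sqrt ((s * Real.cos θ) ^ 2 + (s * Real.sin θ) ^ 2) = s
  rw [show (s * Real.cos θ) ^ 2 + (s * Real.sin θ) ^ 2 = s ^ 2 by
    linear_combination s ^ 2 * Real.sin_sq_add_cos_sq θ, Real.sqrt_sq hs]

/-- Let Z be the square root, y = x + κZ and D = 1 + κx/Z. From m² = (Z - κx)(Z + κx) one gets y² +
m² = 2Z(Z + κx), hence D⁻¹ = (1 + (m/|y|)²)/2. One power of D is kept as a Jacobian and D^{-(2-r)/2}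
is estimated by this identity. -/
theorem rpow_defect_le {r x m κ : ℝ} (hr2 : r ≤ 2) (hκ : κ ^ 2 = 1) (hm : 0 < m) :
    (1 + κ * (x / Real.sqrt (x ^ 2 + m ^ 2))) ^ (r / 2) ≤
      |1 + κ * (x / Real.sqrt (x ^ 2 + m ^ 2))| *
        (1 + (m / |x + κ * Real.sqrt (x ^ 2 + m ^ 2)|) ^ (2 - r)) := by
  set Z := Real.sqrt (x ^ 2 + m ^ 2) with hZ
  have hZ2 : Z ^ 2 = x ^ 2 + m ^ 2 := Real.sq_sqrt (by positivity)
  have hZp : 0 < Z := Real.sqrt_pos.2 (by positivity)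
  have hxZ : |κ * x| < Z := by
    refine abs_lt_of_sq_lt_sq ?_ hZp.le
    rw [mul_pow, hκ, hZ2]; nlinarith
  have hpos : 0 < Z + κ * x := by linarith [(abs_lt.1 hxZ).1]
  set y := x + κ * Z with hy
  have hκy : κ * y = Z + κ * x := by rw [hy]; linear_combination Z * hκ
  have hy2 : y ^ 2 = (Z + κ * x) ^ 2 := by rw [← hκy, mul_pow, hκ, one_mul]
  have hyp : 0 < |y| := by
    rw [abs_pos]; intro h; rw [h] at hy2; nlinarith
  have hD : 1 + κ * (x / Z) = (Z + κ * x) / Z := by field_simp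
  have hDpos : 0 < 1 + κ * (x / Z) := by rw [hD]; positivity
  have hD2 : (1 + κ * (x / Z)) * (y ^ 2 + m ^ 2) = 2 * y ^ 2 := by
    have e : (Z + κ * x) ^ 2 + m ^ 2 = 2 * Z * (Z + κ * x) := by
      linear_combination x ^ 2 * hκ - hZ2
    rw [hD, hy2, e]; field_simp
  have hγ : 0 ≤ 2 - r := by linarith
  have hq : 0 ≤ m / |y| := by positivity
  have hinv : (1 + κ * (x / Z))⁻¹ ≤ (max 1 (m / |y|)) ^ 2 := by
    have h1 : (1 + κ * (x / Z))⁻¹ = (1 + (m / |y|) ^ 2) / 2 := by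
      rw [div_pow, sq_abs]
      have : y ^ 2 ≠ 0 := by rw [← sq_abs]; positivity
      refine inv_eq_of_mul_eq_one_right ?_
      rw [show (1 + m ^ 2 / y ^ 2) / 2 = (y ^ 2 + m ^ 2) / (2 * y ^ 2) by
        rw [mul_comm (2 : ℝ), ← div_div, add_div (y ^ 2), div_self this],
        ← mul_div_assoc, hD2, div_self (by positivity)]
    rw [h1]
    rcases max_cases 1 (m / |y|) with h | h <;> rw [h.1] <;> nlinarith
  have hM : (max 1 (m / |y|)) ^ (2 - r) ≤ 1 + (m / |y|) ^ (2 - r) := by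
    have := Real.rpow_nonneg hq (2 - r)
    rcases max_cases 1 (m / |y|) with h | h <;> rw [h.1]
    · rw [Real.one_rpow]; linarith
    · linarith
  rw [abs_of_pos hDpos]
  calc (1 + κ * (x / Z)) ^ (r / 2)
      = (1 + κ * (x / Z)) * ((1 + κ * (x / Z))⁻¹) ^ ((2 - r) / 2) := by
        rw [Real.inv_rpow hDpos.le, ← Real.rpow_neg hDpos.le]
        nth_rewrite 2 [← Real.rpow_one (1 + κ * (x / Z))]
        rw [← Real.rpow_add hDpos]; congr 1; ring
    _ ≤ (1 + κ * (x / Z)) * ((max 1 (m / |y|)) ^ 2) ^ ((2 - r) / 2) := by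
        gcongr
    _ = (1 + κ * (x / Z)) * (max 1 (m / |y|)) ^ (2 - r) := by
        rw [← Real.rpow_natCast, ← Real.rpow_mul (by positivity)]; congr 2; push_cast; ring
    _ ≤ _ := by gcongr

/-- The defect is the derivative of s ↦ s + κ√((s-c)² + m²). It is positive for either sign of κ
because m > 0, so the map is injective and the change of variables applies. -/
theorem lintegral_radial_le {r c m κ : ℝ} (hr2 : r ≤ 2) (hκ : κ ^ 2 = 1) (hm : 0 < m)
    (Ψ : ℝ → ℝ≥0∞) :
    ∫⁻ s in Set.Ioi (0 : ℝ), Ψ (s + κ * Real.sqrt ((s - c) ^ 2 + m ^ 2)) *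
        ENNReal.ofReal ((1 + κ * ((s - c) / Real.sqrt ((s - c) ^ 2 + m ^ 2))) ^ (r / 2)) ≤
      ∫⁻ t, Ψ t * ENNReal.ofReal (1 + (m / |t - c|) ^ (2 - r)) := by
  set f : ℝ → ℝ := fun s => s + κ * Real.sqrt ((s - c) ^ 2 + m ^ 2) with hf
  set f' : ℝ → ℝ := fun s => 1 + κ * ((s - c) / Real.sqrt ((s - c) ^ 2 + m ^ 2)) with hf'
  have hpos : ∀ s, 0 < (s - c) ^ 2 + m ^ 2 := fun s => by positivity
  have hder : ∀ s, HasDerivAt f (f' s) s := by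
    intro s
    have h1 : HasDerivAt (fun s : ℝ => (s - c) ^ 2 + m ^ 2) (2 * (s - c)) s := by
      have := (((hasDerivAt_id s).sub_const c).pow 2).add_const (m ^ 2)
      simpa using this
    have h2 := ((h1.sqrt (hpos s).ne').const_mul κ)
    have h3 := (hasDerivAt_id s).add h2
    refine h3.congr_deriv ?_
    simp only [hf']
    congr 2
    rw [mul_div_mul_left _ _ two_ne_zero]
  have hf'pos : ∀ s, 0 < f' s := by
    intro s
    have hZ := Real.sqrt_pos.2 (hpos s)
    have : |κ * (s - c)| < Real.sqrt ((s - c) ^ 2 + m ^ 2) := by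
      refine abs_lt_of_sq_lt_sq ?_ hZ.le
      rw [mul_pow, hκ, Real.sq_sqrt (hpos s).le]; nlinarith
    have h2 := (abs_lt.1 this).1
    simp only [hf']
    rw [← mul_div_assoc, ← sub_neg_eq_add, sub_pos, neg_lt, neg_eq_neg_one_mul, lt_div_iff₀ hZ]
    linarith
  have hinj : Function.Injective f :=
    (strictMono_of_hasDerivAt_pos hder hf'pos).injective
  have key := lintegral_image_eq_lintegral_abs_deriv_mul (s := Set.Ioi (0 : ℝ)) measurableSet_Ioi
    (fun s _ => (hder s).hasDerivWithinAt) hinj.injOn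
    (fun t => Ψ t * ENNReal.ofReal (1 + (m / |t - c|) ^ (2 - r)))
  refine le_trans ?_ ((le_of_eq key.symm).trans (setLIntegral_le_lintegral _ _))
  refine lintegral_mono fun s => ?_
  have h := rpow_defect_le (x := s - c) hr2 hκ hm
  have hsub : s - c + κ * Real.sqrt ((s - c) ^ 2 + m ^ 2) = f s - c := by simp only [hf]; ring
  rw [hsub] at h
  calc _ ≤ Ψ (f s) * (ENNReal.ofReal |f' s| *
        ENNReal.ofReal (1 + (m / |f s - c|) ^ (2 - r))) := by
        rw [← ENNReal.ofReal_mul (abs_nonneg _)]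
        exact mul_le_mul_right (ENNReal.ofReal_le_ofReal h) _
    _ = _ := by ring

theorem exists_polar (x y : ℝ) :
    ∃ φ : ℝ, x = Real.sqrt (x ^ 2 + y ^ 2) * Real.cos φ ∧
      y = Real.sqrt (x ^ 2 + y ^ 2) * Real.sin φ := by
  refine ⟨Complex.arg ⟨x, y⟩, ?_, ?_⟩
  · have := Complex.norm_mul_cos_arg ⟨x, y⟩
    rw [Complex.norm_def, Complex.normSq_mk, ← sq, ← sq] at this
    exact this.symm
  · have := Complex.norm_mul_sin_arg ⟨x, y⟩
    rw [Complex.norm_def, Complex.normSq_mk, ← sq, ← sq] at this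
    exact this.symm

theorem ae_sin_add_ne_zero (φ : ℝ) : ∀ᵐ θ : ℝ, Real.sin (θ + φ) ≠ 0 := by
  have hc : Set.Countable {θ : ℝ | Real.sin (θ + φ) = 0} := by
    refine (Set.countable_range (fun n : ℤ => (n : ℝ) * Real.pi - φ)).mono ?_
    intro θ hθ
    obtain ⟨n, hn⟩ := Real.sin_eq_zero_iff.1 hθ
    exact ⟨n, by simp only [hn]; ring⟩
  have := hc.measure_zero volume
  rw [ae_iff]; simpa using this

/-- Measured from the direction φ of ξ = (x, y), the ray at angle θ sees ξ at height c = ρ cos(θ-φ)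
along it and at distance m = ρ|sin(θ-φ)| from its line. The radial substitution is made for each θ;
Fubini then puts the angular integral inside at fixed t. -/
theorem exists_planar_bound {r : ℝ} (hr1 : 1 < r) (hr2 : r ≤ 2) :
    ∃ B : ℝ≥0∞, B ≠ ∞ ∧ ∀ x y κ : ℝ, 0 < Real.sqrt (x ^ 2 + y ^ 2) → κ ^ 2 = 1 →
      ∀ Ψ : ℝ → ℝ≥0∞, Measurable Ψ →
      ∫⁻ θ in Set.Ioc (-Real.pi) Real.pi, ∫⁻ s in Set.Ioi (0 : ℝ),
        Ψ (s + κ * Real.sqrt ((x - s * Real.cos θ) ^ 2 + (y - s * Real.sin θ) ^ 2)) *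
          ENNReal.ofReal ((1 - κ * ((s * Real.cos θ * (x - s * Real.cos θ) +
            s * Real.sin θ * (y - s * Real.sin θ)) /
            (s * Real.sqrt ((x - s * Real.cos θ) ^ 2 + (y - s * Real.sin θ) ^ 2)))) ^ (r / 2)) ≤
      B * ∫⁻ t, Ψ t := by
  obtain ⟨B, hB, hang⟩ := exists_angular_bound (γ := 2 - r) (by linarith) (by linarith)
  refine ⟨ENNReal.ofReal (2 * Real.pi) + B, ENNReal.add_ne_top.2 ⟨ENNReal.ofReal_ne_top, hB⟩,
    fun x y κ hρ hκ Ψ hΨ => ?_⟩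
  obtain ⟨φ, hx, hy⟩ := exists_polar x y
  set ρ := Real.sqrt (x ^ 2 + y ^ 2) with hρd
  have hquad : ∀ s θ : ℝ, (x - s * Real.cos θ) ^ 2 + (y - s * Real.sin θ) ^ 2 =
      (s - ρ * Real.cos (θ + -φ)) ^ 2 + (ρ * |Real.sin (θ + -φ)|) ^ 2 := by
    intro s θ
    rw [mul_pow, sq_abs, hx, hy, Real.cos_add, Real.sin_add, Real.cos_neg, Real.sin_neg]
    have h1 := Real.sin_sq_add_cos_sq θ
    have h2 := Real.sin_sq_add_cos_sq φ
    linear_combination (s ^ 2 - ρ ^ 2 * (Real.sin φ ^ 2 + Real.cos φ ^ 2)) * h1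
  have hdot : ∀ s θ : ℝ, s * Real.cos θ * (x - s * Real.cos θ) +
      s * Real.sin θ * (y - s * Real.sin θ) = - (s * (s - ρ * Real.cos (θ + -φ))) := by
    intro s θ
    rw [hx, hy, Real.cos_add, Real.cos_neg, Real.sin_neg]
    have h1 := Real.sin_sq_add_cos_sq θ
    linear_combination (- s ^ 2) * h1
  have hmeas : Measurable (fun q : ℝ × ℝ => Ψ q.2 *
      ENNReal.ofReal (1 + (ρ * |Real.sin (q.1 + -φ)| / |q.2 - ρ * Real.cos (q.1 + -φ)|) ^
        (2 - r))) := by fun_prop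
  calc _ ≤ ∫⁻ θ in Set.Ioc (-Real.pi) Real.pi, ∫⁻ t, Ψ t * ENNReal.ofReal
        (1 + (ρ * |Real.sin (θ + -φ)| / |t - ρ * Real.cos (θ + -φ)|) ^ (2 - r)) := by
        refine lintegral_mono_ae (ae_restrict_of_ae ?_)
        -- Rays parallel to ξ have m = 0 and must be discarded.
        filter_upwards [ae_sin_add_ne_zero (-φ)] with θ hθ
        have hm : 0 < ρ * |Real.sin (θ + -φ)| := mul_pos hρ (abs_pos.2 hθ)
        refine le_trans (le_of_eq ?_)
          (lintegral_radial_le (c := ρ * Real.cos (θ + -φ)) hr2 hκ hm Ψ)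
        refine setLIntegral_congr_fun measurableSet_Ioi fun s hs => ?_
        have hs' : s ≠ 0 := ne_of_gt hs
        simp only [hquad, hdot]
        rw [neg_div, mul_div_mul_left _ _ hs', mul_neg, sub_neg_eq_add]
    _ = ∫⁻ t, ∫⁻ θ in Set.Ioc (-Real.pi) Real.pi, Ψ t * ENNReal.ofReal
        (1 + (ρ * |Real.sin (θ + -φ)| / |t - ρ * Real.cos (θ + -φ)|) ^ (2 - r)) :=
        lintegral_lintegral_swap hmeas.aemeasurable
    _ ≤ ∫⁻ t, Ψ t * (ENNReal.ofReal (2 * Real.pi) + B) := by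
        refine lintegral_mono fun t => ?_
        rw [lintegral_const_mul _ (by fun_prop)]
        gcongr
        calc _ = ∫⁻ θ in Set.Ioc (-Real.pi) Real.pi, (1 + ENNReal.ofReal
              ((ρ * |Real.sin (θ + -φ)| / |t - ρ * Real.cos (θ + -φ)|) ^ (2 - r))) := by
              refine lintegral_congr fun θ => ?_
              rw [ENNReal.ofReal_add zero_le_one (by positivity), ENNReal.ofReal_one]
          _ ≤ _ := by
              rw [lintegral_add_left measurable_const, setLIntegral_const, one_mul,
                Real.volume_Ioc, show Real.pi - -Real.pi = 2 * Real.pi by ring]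
              gcongr
              exact hang ρ hρ t (-φ)
    _ = _ := by rw [lintegral_mul_const _ hΨ, mul_comm]

theorem lintegral_comp_add_sign_mul {W : ℝ → ℝ≥0∞} {σ : ℝ} (hσ : σ = 1 ∨ σ = -1) (T : ℝ) :
    ∫⁻ t, W (T + σ * t) = ∫⁻ t, W t := by
  rcases hσ with rfl | rfl
  · simp only [one_mul]; exact lintegral_add_left_eq_self W T
  · simp only [neg_one_mul, ← sub_eq_add_neg]; exact lintegral_sub_left_eq_self W T

theorem measurable_angDefect (κ : ℝ) :
    Measurable fun q : SpaceTime × SpaceTime => angDefect κ q.1 q.2 := by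
  unfold angDefect; fun_prop

theorem measurable_angDefect_sub (κ : ℝ) (p : SpaceTime) :
    Measurable fun k : SpaceTime => angDefect κ k (p - k) :=
  (measurable_angDefect κ).comp (measurable_id.prodMk (measurable_const.sub measurable_id))

/-- The factor |η|⁻¹ is the inverse of the polar Jacobian. After the shift a = τ + σ₁s, the second
modulation depends on η only through s + σ₁σ₂|ξ-η|, which is the situation of `exists_planar_bound`.
-/
theorem exists_kernel_bound {r : ℝ} (hr1 : 1 < r) (hr2 : r ≤ 2) :
    ∃ B : ℝ≥0∞, B ≠ ∞ ∧ ∀ σ₁ σ₂ : ℝ, (σ₁ = 1 ∨ σ₁ = -1) → (σ₂ = 1 ∨ σ₂ = -1) →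
      ∀ W : ℝ → ℝ≥0∞, Measurable W → ∀ p : SpaceTime, 0 < spNorm p →
      ∫⁻ k : SpaceTime, W (k 0 + σ₁ * spNorm k) * W (p 0 - k 0 + σ₂ * spNorm (p - k)) *
        ENNReal.ofReal (angDefect (σ₁ * σ₂) k (p - k) ^ (r / 2)) * ENNReal.ofReal (spNorm k)⁻¹ ≤
      B * (∫⁻ t, W t) ^ 2 := by
  obtain ⟨B, hB, hpl⟩ := exists_planar_bound hr1 hr2
  refine ⟨B, hB, fun σ₁ σ₂ h₁ h₂ W hW p hp => ?_⟩
  have h₁2 : σ₁ ^ 2 = 1 := by rcases h₁ with rfl | rfl <;> norm_num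
  have h₂2 : σ₂ ^ 2 = 1 := by rcases h₂ with rfl | rfl <;> norm_num
  have hD := measurable_angDefect_sub (σ₁ * σ₂) p
  rw [lintegral_polar (by fun_prop)]
  set Z : ℝ → ℝ → ℝ := fun θ s =>
    Real.sqrt ((p 1 - s * Real.cos θ) ^ 2 + (p 2 - s * Real.sin θ) ^ 2) with hZ
  set D : ℝ → ℝ → ℝ := fun θ s => 1 - (σ₁ * σ₂) * ((s * Real.cos θ * (p 1 - s * Real.cos θ) +
            s * Real.sin θ * (p 2 - s * Real.sin θ)) / (s * Z θ s)) with hDd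
  have hmZ : Measurable (fun q : ℝ × ℝ => Z q.1 q.2) := by simp only [hZ]; fun_prop
  have hmD : Measurable (fun q : ℝ × ℝ => D q.1 q.2) := by simp only [hDd]; fun_prop
  have hpt : ∀ τ θ s : ℝ, 0 < s →
      ENNReal.ofReal s * (W ((!₂[τ, s * Real.cos θ, s * Real.sin θ] : SpaceTime) 0 +
        σ₁ * spNorm !₂[τ, s * Real.cos θ, s * Real.sin θ]) *
        W (p 0 - (!₂[τ, s * Real.cos θ, s * Real.sin θ] : SpaceTime) 0 +
          σ₂ * spNorm (p - !₂[τ, s * Real.cos θ, s * Real.sin θ])) *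
        ENNReal.ofReal (angDefect (σ₁ * σ₂) !₂[τ, s * Real.cos θ, s * Real.sin θ]
          (p - !₂[τ, s * Real.cos θ, s * Real.sin θ]) ^ (r / 2)) *
        ENNReal.ofReal (spNorm !₂[τ, s * Real.cos θ, s * Real.sin θ])⁻¹) =
      W (τ + σ₁ * s) * W (p 0 - τ + σ₂ * Z θ s) * ENNReal.ofReal (D θ s ^ (r / 2)) := by
    intro τ θ s hs
    have hn := spNorm_polar τ θ hs.le
    have hn' : spNorm (p - !₂[τ, s * Real.cos θ, s * Real.sin θ]) = Z θ s := rfl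
    have hd : angDefect (σ₁ * σ₂) !₂[τ, s * Real.cos θ, s * Real.sin θ]
          (p - !₂[τ, s * Real.cos θ, s * Real.sin θ]) = D θ s := by
      simp only [angDefect, hn, hn']; rfl
    rw [hn, hn', hd, show (!₂[τ, s * Real.cos θ, s * Real.sin θ] : SpaceTime) 0 = τ from rfl,
      mul_comm, mul_assoc _ (ENNReal.ofReal s⁻¹), ← ENNReal.ofReal_mul (inv_nonneg.2 hs.le),
      inv_mul_cancel₀ hs.ne', ENNReal.ofReal_one, mul_one]
  have hmΨ : ∀ a : ℝ, Measurable (fun t => W (p 0 - a + σ₁ * t)) := fun a => by fun_prop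
  calc _ = ∫⁻ τ : ℝ, ∫⁻ θ in Set.Ioc (-Real.pi) Real.pi, ∫⁻ s in Set.Ioi (0 : ℝ),
        W (τ + σ₁ * s) * W (p 0 - τ + σ₂ * Z θ s) * ENNReal.ofReal (D θ s ^ (r / 2)) := by
        refine lintegral_congr fun τ => lintegral_congr fun θ => ?_
        exact setLIntegral_congr_fun measurableSet_Ioi fun s hs => hpt τ θ s hs
    _ = ∫⁻ θ in Set.Ioc (-Real.pi) Real.pi, ∫⁻ s in Set.Ioi (0 : ℝ), ∫⁻ τ : ℝ,
        W (τ + σ₁ * s) * W (p 0 - τ + σ₂ * Z θ s) * ENNReal.ofReal (D θ s ^ (r / 2)) := by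
        have hm3 : Measurable (fun q : (ℝ × ℝ) × ℝ =>
            W (q.1.1 + σ₁ * q.2) * W (p 0 - q.1.1 + σ₂ * Z q.1.2 q.2) *
              ENNReal.ofReal (D q.1.2 q.2 ^ (r / 2))) := by
          have := hmZ.comp (show Measurable (fun q : (ℝ × ℝ) × ℝ => (q.1.2, q.2)) by fun_prop)
          have := hmD.comp (show Measurable (fun q : (ℝ × ℝ) × ℝ => (q.1.2, q.2)) by fun_prop)
          simp only [Function.comp_def] at *
          fun_prop
        rw [lintegral_lintegral_swap (Measurable.lintegral_prod_right' hm3).aemeasurable]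
        refine lintegral_congr fun θ => ?_
        exact lintegral_lintegral_swap (hm3.comp
          (show Measurable (fun q : ℝ × ℝ => ((q.1, θ), q.2)) by fun_prop)).aemeasurable
    _ = ∫⁻ θ in Set.Ioc (-Real.pi) Real.pi, ∫⁻ s in Set.Ioi (0 : ℝ), ∫⁻ a : ℝ,
        W a * (W (p 0 - a + σ₁ * (s + σ₁ * σ₂ * Z θ s)) * ENNReal.ofReal (D θ s ^ (r / 2))) := by
        refine lintegral_congr fun θ => lintegral_congr fun s => ?_
        -- Substitute τ = a - σ₁s; since σ₁² = 1, σ₂Z = σ₁(σ₁σ₂Z), so the sign σ₁ factors out of s +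
        -- κZ.
        rw [← lintegral_sub_right_eq_self _ (σ₁ * s)]
        refine lintegral_congr fun a => ?_
        rw [sub_add_cancel, mul_assoc]
        congr 3
        linear_combination (-σ₂ * Z θ s) * h₁2
    _ = ∫⁻ a : ℝ, ∫⁻ θ in Set.Ioc (-Real.pi) Real.pi, ∫⁻ s in Set.Ioi (0 : ℝ),
        W a * (W (p 0 - a + σ₁ * (s + σ₁ * σ₂ * Z θ s)) * ENNReal.ofReal (D θ s ^ (r / 2))) := by
        have hm3 : Measurable (fun q : (ℝ × ℝ) × ℝ =>
            W q.1.1 * (W (p 0 - q.1.1 + σ₁ * (q.2 + σ₁ * σ₂ * Z q.1.2 q.2)) *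
              ENNReal.ofReal (D q.1.2 q.2 ^ (r / 2)))) := by
          have := hmZ.comp (show Measurable (fun q : (ℝ × ℝ) × ℝ => (q.1.2, q.2)) by fun_prop)
          have := hmD.comp (show Measurable (fun q : (ℝ × ℝ) × ℝ => (q.1.2, q.2)) by fun_prop)
          simp only [Function.comp_def] at *
          fun_prop
        symm
        rw [lintegral_lintegral_swap (Measurable.lintegral_prod_right' hm3).aemeasurable]
        refine lintegral_congr fun θ => ?_
        exact (lintegral_lintegral_swap (hm3.comp
          (show Measurable (fun q : ℝ × ℝ => ((q.1, θ), q.2)) by fun_prop)).aemeasurable)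
    _ ≤ ∫⁻ a : ℝ, W a * (B * ∫⁻ t, W t) := by
        refine lintegral_mono fun a => ?_
        have hm2 : Measurable (fun q : ℝ × ℝ =>
            (W (p 0 - a + σ₁ * (q.2 + σ₁ * σ₂ * Z q.1 q.2)) *
              ENNReal.ofReal (D q.1 q.2 ^ (r / 2)))) := by fun_prop
        have h := hpl (p 1) (p 2) (σ₁ * σ₂) hp (by rw [mul_pow, h₁2, h₂2, one_mul])
          (fun t => W (p 0 - a + σ₁ * t)) (hmΨ a)
        rw [lintegral_comp_add_sign_mul h₁] at h
        refine le_trans (le_of_eq ?_) (mul_le_mul_right h (W a))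
        rw [← lintegral_const_mul _ (Measurable.lintegral_prod_right' hm2)]
        refine lintegral_congr fun θ => ?_
        exact lintegral_const_mul _ (hm2.comp
          (show Measurable (fun s : ℝ => (θ, s)) by fun_prop))
    _ = _ := by rw [lintegral_mul_const _ hW]; ring

/-! ### Weights -/

theorem one_le_bracket (a : ℝ) : 1 ≤ bracket a := by
  rw [bracket, Real.one_le_sqrt]; nlinarith [sq_nonneg a]

theorem bracket_pos (a : ℝ) : 0 < bracket a := one_pos.trans_le (one_le_bracket a)

theorem le_bracket (a : ℝ) : a ≤ bracket a := Real.le_sqrt_of_sq_le (by linarith)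

@[fun_prop]
theorem measurable_bracket : Measurable bracket := by unfold bracket; fun_prop

theorem xWeight_pos (s b : ℝ) (σ : ℤˣ) (p : SpaceTime) : 0 < xWeight s b σ p :=
  mul_pos (Real.rpow_pos_of_pos (bracket_pos _) _) (Real.rpow_pos_of_pos (bracket_pos _) _)

@[fun_prop]
theorem measurable_xWeight (s b : ℝ) (σ : ℤˣ) : Measurable (xWeight s b σ) := by
  unfold xWeight; fun_prop

theorem sgn_eq (σ : ℤˣ) : sgn σ = 1 ∨ sgn σ = -1 := by
  rcases Int.units_eq_one_or σ with rfl | rfl <;> simp [sgn]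

theorem hWeight_zero_zero (p : SpaceTime) : hWeight 0 0 p = 1 := by simp [hWeight]

theorem lintegral_bracket_rpow_lt_top {β : ℝ} (hβ : 1 < β) :
    ∫⁻ t, ENNReal.ofReal (bracket t ^ (-β)) < ∞ := by
  have h := integrable_rpow_neg_one_add_norm_sq (E := ℝ) (μ := volume) (r := β) (by simpa using hβ)
  refine lt_of_le_of_lt (lintegral_mono fun t => le_of_eq ?_) h.lintegral_lt_top
  congr 1
  rw [bracket, Real.sqrt_eq_rpow, ← Real.rpow_mul (by positivity), Real.norm_eq_abs, sq_abs]
  congr 1; ring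

/-- As the exponents are nonpositive, the larger bracket may be replaced by the smaller one, whose
total exponent is then at most -1. -/
theorem bracket_rpow_mul_le {x y A B : ℝ} (hx : 0 < x) (hy : 0 < y) (hA : 0 ≤ A) (hB : 0 ≤ B)
    (hAB : 1 ≤ A + B) : bracket x ^ (-A) * bracket y ^ (-B) ≤ x⁻¹ + y⁻¹ := by
  have main : ∀ {u v A B : ℝ}, 0 < u → u ≤ v → 0 ≤ A → 0 ≤ B → 1 ≤ A + B →
      bracket u ^ (-A) * bracket v ^ (-B) ≤ u⁻¹ := by
    intro u v A B hu huv hA hB hAB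
    have hle : bracket u ≤ bracket v := Real.sqrt_le_sqrt (by gcongr)
    have h1 : bracket v ^ (-B) ≤ bracket u ^ (-B) :=
      Real.rpow_le_rpow_of_nonpos (bracket_pos u) hle (by linarith)
    calc _ ≤ bracket u ^ (-A) * bracket u ^ (-B) :=
          mul_le_mul_of_nonneg_left h1 (Real.rpow_nonneg (bracket_pos u).le _)
      _ = bracket u ^ (-(A + B)) := by rw [← Real.rpow_add (bracket_pos u)]; congr 1; ring
      _ ≤ bracket u ^ (-1 : ℝ) :=
          Real.rpow_le_rpow_of_exponent_le (one_le_bracket u) (by linarith)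
      _ = (bracket u)⁻¹ := Real.rpow_neg_one _
      _ ≤ u⁻¹ := inv_anti₀ hu (le_bracket u)
  have hx' : 0 < x⁻¹ := inv_pos.2 hx
  have hy' : 0 < y⁻¹ := inv_pos.2 hy
  rcases le_total x y with h | h
  · linarith [main hx h hA hB hAB]
  · have := main hy h hB hA (by linarith)
    rw [mul_comm] at this; linarith

theorem ae_spNorm_pos : ∀ᵐ p : SpaceTime, 0 < spNorm p := by
  have hs : ∀ᵐ x : ℝ × ℝ × ℝ, x.2.1 ≠ 0 := by
    have h0 : ∀ᵐ y : ℝ, y ≠ 0 := Measure.ae_ne volume 0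
    have h1 : ∀ᵐ x : ℝ × ℝ, x.1 ≠ 0 :=
      (Measure.quasiMeasurePreserving_fst (μ := (volume : Measure ℝ))
        (ν := (volume : Measure ℝ))).ae h0
    exact (Measure.quasiMeasurePreserving_snd (μ := (volume : Measure ℝ))
        (ν := (volume : Measure (ℝ × ℝ)))).ae h1
  filter_upwards [measurePreserving_coords.quasiMeasurePreserving.ae hs] with p hp
  exact Real.sqrt_pos.2 (by have : 0 < p 1 ^ 2 := by positivity
                            nlinarith [sq_nonneg (p 2)])

theorem angDefect_comm (κ : ℝ) (k l : SpaceTime) : angDefect κ k l = angDefect κ l k := by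
  simp only [angDefect]
  rw [mul_comm (k 1), mul_comm (k 2), mul_comm (spNorm k)]

/-- The kernel in Hölder's inequality. -/
def holderKernel (m : SpaceTime → SpaceTime → ℂ) (α₁ α₂ b : ℝ) (σ₁ σ₂ : ℤˣ)
    (p k : SpaceTime) : ℝ :=
  ‖m k (p - k)‖ * (xWeight α₁ b σ₁ k)⁻¹ * (xWeight α₂ b σ₂ (p - k))⁻¹

theorem holderKernel_rpow_le {r α₁ α₂ b : ℝ} (hr1 : 1 < r) (hr2 : r ≤ 2) (hα₁ : 0 ≤ α₁)
    (hα₂ : 0 ≤ α₂) (hα : 1 / r ≤ α₁ + α₂) {σ₁ σ₂ : ℤˣ} {m : SpaceTime → SpaceTime → ℂ}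
    (hm : ∀ k l, ‖m k l‖ ^ 2 ≤ 2 * angDefect (sgn σ₁ * sgn σ₂) k l) {p k : SpaceTime}
    (hk : 0 < spNorm k) (hl : 0 < spNorm (p - k)) :
    holderKernel m α₁ α₂ b σ₁ σ₂ p k ^ r ≤
      2 * (bracket (k 0 + sgn σ₁ * spNorm k) ^ (-(b * r)) *
        bracket (p 0 - k 0 + sgn σ₂ * spNorm (p - k)) ^ (-(b * r)) *
        angDefect (sgn σ₁ * sgn σ₂) k (p - k) ^ (r / 2) * ((spNorm k)⁻¹ + (spNorm (p - k))⁻¹)) := by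
  have hr0 : 0 < r := by linarith
  set D := angDefect (sgn σ₁ * sgn σ₂) k (p - k) with hD
  have hm' := hm k (p - k)
  rw [← hD] at hm'
  -- The sign of the defect is read off from the symbol bound; no Cauchy–Schwarz inequality is
  -- needed.
  have hD0 : 0 ≤ D := by nlinarith [sq_nonneg ‖m k (p - k)‖]
  have hmr : ‖m k (p - k)‖ ^ r ≤ 2 * D ^ (r / 2) := by
    calc ‖m k (p - k)‖ ^ r = (‖m k (p - k)‖ ^ 2) ^ (r / 2) := by
          rw [← Real.rpow_natCast, ← Real.rpow_mul (norm_nonneg _)]; congr 1; push_cast; ring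
      _ ≤ (2 * D) ^ (r / 2) := Real.rpow_le_rpow (by positivity) hm' (by linarith)
      _ = 2 ^ (r / 2) * D ^ (r / 2) := Real.mul_rpow (by norm_num) hD0
      _ ≤ 2 ^ (1 : ℝ) * D ^ (r / 2) := by
          gcongr
          · norm_num
          · linarith
      _ = _ := by rw [Real.rpow_one]
  have hx : ∀ (s : ℝ) (σ : ℤˣ) (q : SpaceTime), ((xWeight s b σ q)⁻¹) ^ r =
      bracket (spNorm q) ^ (-(s * r)) * bracket (q 0 + sgn σ * spNorm q) ^ (-(b * r)) := by
    intro s σ q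
    have h1 := (bracket_pos (spNorm q)).le
    have h2 := (bracket_pos (q 0 + sgn σ * spNorm q)).le
    rw [xWeight, mul_inv, ← Real.rpow_neg h1, ← Real.rpow_neg h2,
      Real.mul_rpow (Real.rpow_nonneg h1 _) (Real.rpow_nonneg h2 _), ← Real.rpow_mul h1,
      ← Real.rpow_mul h2, neg_mul, neg_mul]
  have hb := bracket_rpow_mul_le (A := α₁ * r) (B := α₂ * r) hk hl (by positivity) (by positivity)
    (by rw [div_le_iff₀ hr0] at hα; linarith)
  have hw1 := (xWeight_pos α₁ b σ₁ k).le
  have hw2 := (xWeight_pos α₂ b σ₂ (p - k)).le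
  rw [holderKernel, Real.mul_rpow (by positivity) (by positivity),
    Real.mul_rpow (by positivity) (by positivity), hx, hx]
  have e0 : (p - k) 0 = p 0 - k 0 := rfl
  rw [e0]
  have g1 := Real.rpow_nonneg (bracket_pos (k 0 + sgn σ₁ * spNorm k)).le (-(b * r))
  have g2 := Real.rpow_nonneg (bracket_pos (p 0 - k 0 + sgn σ₂ * spNorm (p - k))).le (-(b * r))
  have g3 : 0 ≤ D ^ (r / 2) := Real.rpow_nonneg hD0 _
  have g4 := Real.rpow_nonneg (bracket_pos (spNorm k)).le (-(α₁ * r))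
  have g5 := Real.rpow_nonneg (bracket_pos (spNorm (p - k))).le (-(α₂ * r))
  calc _ = (‖m k (p - k)‖ ^ r) * (bracket (k 0 + sgn σ₁ * spNorm k) ^ (-(b * r)) *
        bracket (p 0 - k 0 + sgn σ₂ * spNorm (p - k)) ^ (-(b * r))) *
        (bracket (spNorm k) ^ (-(α₁ * r)) * bracket (spNorm (p - k)) ^ (-(α₂ * r))) := by ring
    _ ≤ (2 * D ^ (r / 2)) * (bracket (k 0 + sgn σ₁ * spNorm k) ^ (-(b * r)) *
        bracket (p 0 - k 0 + sgn σ₂ * spNorm (p - k)) ^ (-(b * r))) *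
        ((spNorm k)⁻¹ + (spNorm (p - k))⁻¹) := by gcongr
    _ = _ := by ring

/-- The two terms |η|⁻¹ and |ξ-η|⁻¹ are exchanged by k ↦ p - k together with a swap of the signs, so
`exists_kernel_bound` is applied twice. -/
theorem exists_lintegral_holderKernel_le {r α₁ α₂ b : ℝ} (hr1 : 1 < r) (hr2 : r ≤ 2)
    (hα₁ : 0 ≤ α₁) (hα₂ : 0 ≤ α₂) (hα : 1 / r ≤ α₁ + α₂) (hb : 1 / r < b) :
    ∃ A : ℝ≥0∞, A ≠ ∞ ∧ ∀ (σ₁ σ₂ : ℤˣ) (m : SpaceTime → SpaceTime → ℂ),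
      (∀ k l, ‖m k l‖ ^ 2 ≤ 2 * angDefect (sgn σ₁ * sgn σ₂) k l) → ∀ p, 0 < spNorm p →
      ∫⁻ k, ENNReal.ofReal (holderKernel m α₁ α₂ b σ₁ σ₂ p k) ^ r ≤ A := by
  obtain ⟨B, hB, hker⟩ := exists_kernel_bound hr1 hr2
  have hr0 : 0 < r := by linarith
  set W : ℝ → ℝ≥0∞ := fun t => ENNReal.ofReal (bracket t ^ (-(b * r))) with hW
  have hWm : Measurable W := by simp only [hW]; fun_prop
  have hWi : ∫⁻ t, W t ≠ ∞ :=
    (lintegral_bracket_rpow_lt_top (by rwa [div_lt_iff₀ hr0] at hb)).ne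
  refine ⟨2 * (B * (∫⁻ t, W t) ^ 2 + B * (∫⁻ t, W t) ^ 2), by finiteness,
    fun σ₁ σ₂ m hm p hp => ?_⟩
  have hsub : ∀ᵐ k : SpaceTime, 0 < spNorm (p - k) :=
    (quasiMeasurePreserving_sub_left volume p).ae ae_spNorm_pos
  have hD := measurable_angDefect_sub (sgn σ₁ * sgn σ₂) p
  set T : SpaceTime → ℝ≥0∞ := fun k => W (k 0 + sgn σ₁ * spNorm k) *
    W (p 0 - k 0 + sgn σ₂ * spNorm (p - k)) *
    ENNReal.ofReal (angDefect (sgn σ₁ * sgn σ₂) k (p - k) ^ (r / 2)) with hT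
  have hTm : Measurable T := by simp only [hT]; fun_prop
  have h1 := hker (sgn σ₁) (sgn σ₂) (sgn_eq σ₁) (sgn_eq σ₂) W hWm p hp
  have h2 := hker (sgn σ₂) (sgn σ₁) (sgn_eq σ₂) (sgn_eq σ₁) W hWm p hp
  have h2' : ∫⁻ k, T k * ENNReal.ofReal (spNorm (p - k))⁻¹ ≤ B * (∫⁻ t, W t) ^ 2 := by
    rw [← lintegral_sub_left_eq_self _ p]
    refine le_trans (lintegral_mono fun k => le_of_eq ?_) h2
    simp only [hT]
    rw [sub_sub_cancel, angDefect_comm, mul_comm (sgn σ₁) (sgn σ₂),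
      show (p - k) 0 = p 0 - k 0 from rfl, sub_sub_cancel]
    ring
  calc _ ≤ ∫⁻ k, 2 * (T k * ENNReal.ofReal (spNorm k)⁻¹ +
        T k * ENNReal.ofReal (spNorm (p - k))⁻¹) := by
        refine lintegral_mono_ae ?_
        filter_upwards [ae_spNorm_pos, hsub] with k hk hl
        have hw1 := (xWeight_pos α₁ b σ₁ k).le
        have hw2 := (xWeight_pos α₂ b σ₂ (p - k)).le
        rw [ENNReal.ofReal_rpow_of_nonneg (by unfold holderKernel; positivity) hr0.le]
        refine (ENNReal.ofReal_le_ofReal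
          (holderKernel_rpow_le hr1 hr2 hα₁ hα₂ hα hm hk hl)).trans (le_of_eq ?_)
        have hD0 : 0 ≤ angDefect (sgn σ₁ * sgn σ₂) k (p - k) := by
          nlinarith [sq_nonneg ‖m k (p - k)‖, hm k (p - k)]
        have g1 := Real.rpow_nonneg (bracket_pos (k 0 + sgn σ₁ * spNorm k)).le (-(b * r))
        have g2 := Real.rpow_nonneg
          (bracket_pos (p 0 - k 0 + sgn σ₂ * spNorm (p - k))).le (-(b * r))
        have g3 := Real.rpow_nonneg hD0 (r / 2)
        rw [ENNReal.ofReal_mul (by norm_num), ENNReal.ofReal_mul (by positivity),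
          ENNReal.ofReal_mul (by positivity), ENNReal.ofReal_mul (by positivity),
          ENNReal.ofReal_add (by positivity) (by positivity), mul_add, ENNReal.ofReal_ofNat]
    _ ≤ _ := by
        rw [lintegral_const_mul _ (by fun_prop), lintegral_add_left (by fun_prop)]
        gcongr

/-! ### The bilinear estimate -/

theorem aemeasurable_mul_comp_sub {f g : SpaceTime → ℝ≥0∞} (hf : AEMeasurable f)
    (hg : AEMeasurable g) :
    AEMeasurable (fun q : SpaceTime × SpaceTime => f q.2 * g (q.1 - q.2))
      (volume.prod volume) :=
  hf.comp_snd.mul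
    (hg.comp_quasiMeasurePreserving (quasiMeasurePreserving_sub_of_right_invariant _ _))

theorem lintegral_lintegral_mul_comp_sub {f g : SpaceTime → ℝ≥0∞} (hf : AEMeasurable f)
    (hg : AEMeasurable g) :
    ∫⁻ p, ∫⁻ k, f k * g (p - k) = (∫⁻ k, f k) * ∫⁻ k, g k := by
  rw [lintegral_lintegral_swap (aemeasurable_mul_comp_sub hf hg)]
  rw [← lintegral_mul_const'' _ hf]
  refine lintegral_congr fun k => ?_
  have hgk : AEMeasurable (fun p => g (p - k)) := hg.comp_quasiMeasurePreserving
    (measurePreserving_sub_right volume k).quasiMeasurePreserving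
  rw [lintegral_const_mul'' _ hgk, lintegral_sub_right_eq_self]

/-- The weight is measurable and never vanishes, so it can be divided out. -/
theorem aestronglyMeasurable_of_xWeight_mul {s b : ℝ} {σ : ℤˣ} {F : SpaceTime → ℂ}
    (h : AEStronglyMeasurable (fun p => (xWeight s b σ p : ℂ) * F p) volume) :
    AEStronglyMeasurable F volume := by
  have hm : AEStronglyMeasurable (fun p => ((xWeight s b σ p : ℂ))⁻¹) volume :=
    (show Measurable (fun p => ((xWeight s b σ p : ℂ))⁻¹) by fun_prop).aestronglyMeasurable
  refine (hm.mul h).congr (Filter.Eventually.of_forall fun p => ?_)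
  have : (xWeight s b σ p : ℂ) ≠ 0 := by exact_mod_cast (xWeight_pos s b σ p).ne'
  simp only [Pi.mul_apply]
  field_simp

theorem enorm_bilinIntegrand (m : SpaceTime → SpaceTime → ℂ) (α₁ α₂ b : ℝ) (σ₁ σ₂ : ℤˣ)
    (F G : SpaceTime → ℂ) (p k : SpaceTime) :
    ‖bilinIntegrand m F G p k‖ₑ = ENNReal.ofReal (holderKernel m α₁ α₂ b σ₁ σ₂ p k) *
      (‖(xWeight α₁ b σ₁ k : ℂ) * F k‖ₑ * ‖(xWeight α₂ b σ₂ (p - k) : ℂ) * G (p - k)‖ₑ) := by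
  have h1 := xWeight_pos α₁ b σ₁ k
  have h2 := xWeight_pos α₂ b σ₂ (p - k)
  rw [← ofReal_norm, ← ofReal_norm, ← ofReal_norm,
    ← ENNReal.ofReal_mul (norm_nonneg _),
    ← ENNReal.ofReal_mul (by unfold holderKernel; positivity)]
  congr 1
  simp only [bilinIntegrand, holderKernel, norm_mul, Complex.norm_real, Real.norm_eq_abs,
    abs_of_pos h1, abs_of_pos h2]
  field_simp

/-- Hölder bounds the convolution at p by A^{1/r} times the ℓ-th root, ℓ = r', of the convolution of
the ℓ-th powers of the weighted transforms. Tonelli factors the p-integral of the latter; its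
finiteness also gives absolute convergence for almost every p. The normalising factor (2π)⁻³ is
simply bounded by 1. -/
theorem exists_bilinHat_bound {r α₁ α₂ b : ℝ} (hr1 : 1 < r) (hr2 : r ≤ 2)
    (hα₁ : 0 ≤ α₁) (hα₂ : 0 ≤ α₂) (hα : 1 / r ≤ α₁ + α₂) (hb : 1 / r < b) :
    ∃ C : ℝ≥0, ∀ (σ₁ σ₂ : ℤˣ) (m : SpaceTime → SpaceTime → ℂ),
      (Measurable fun q : SpaceTime × SpaceTime => m q.1 q.2) →
      (∀ k l, ‖m k l‖ ^ 2 ≤ 2 * angDefect (sgn σ₁ * sgn σ₂) k l) →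
      ∀ F G : SpaceTime → ℂ, AEStronglyMeasurable F volume → AEStronglyMeasurable G volume →
        (xHatNorm r α₁ b σ₁ F < ∞ → xHatNorm r α₂ b σ₂ G < ∞ →
          ∀ᵐ p, Integrable (bilinIntegrand m F G p) volume) ∧
        hHatNorm r 0 0 (bilinHat m F G) ≤ C * xHatNorm r α₁ b σ₁ F * xHatNorm r α₂ b σ₂ G := by
  obtain ⟨A, hA, hker⟩ := exists_lintegral_holderKernel_le hr1 hr2 hα₁ hα₂ hα hb
  have hr0 : 0 < r := by linarith
  have hAr : A ^ (1 / r) ≠ ∞ := ENNReal.rpow_ne_top_of_nonneg (by positivity) hA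
  refine ⟨(A ^ (1 / r)).toNNReal, fun σ₁ σ₂ m hmm hm F G hF hG => ?_⟩
  rw [ENNReal.coe_toNNReal hAr]
  set q : ℝ := r / (r - 1) with hq
  have hq0 : 0 < q := div_pos hr0 (by linarith)
  have hconj : r.HolderConjugate q := Real.HolderConjugate.conjExponent hr1
  have hd0 : dualExp r ≠ 0 := by simpa [dualExp] using hq0
  have hdt : dualExp r ≠ ∞ := ENNReal.ofReal_ne_top
  have hdr : (dualExp r).toReal = q := ENNReal.toReal_ofReal hq0.le
  set f : SpaceTime → ℝ≥0∞ := fun k => ‖(xWeight α₁ b σ₁ k : ℂ) * F k‖ₑ with hf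
  set g : SpaceTime → ℝ≥0∞ := fun k => ‖(xWeight α₂ b σ₂ k : ℂ) * G k‖ₑ with hg
  have hfm : AEMeasurable f :=
    ((show Measurable (fun p => ((xWeight α₁ b σ₁ p : ℂ))) by
      fun_prop).aestronglyMeasurable.mul hF).enorm
  have hgm : AEMeasurable g :=
    ((show Measurable (fun p => ((xWeight α₂ b σ₂ p : ℂ))) by
      fun_prop).aestronglyMeasurable.mul hG).enorm
  have hfn : xHatNorm r α₁ b σ₁ F = (∫⁻ k, f k ^ q) ^ (1 / q) := by
    rw [xHatNorm, eLpNorm_eq_lintegral_rpow_enorm_toReal hd0 hdt, hdr]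
  have hgn : xHatNorm r α₂ b σ₂ G = (∫⁻ k, g k ^ q) ^ (1 / q) := by
    rw [xHatNorm, eLpNorm_eq_lintegral_rpow_enorm_toReal hd0 hdt, hdr]
  have hgsub : ∀ p, AEMeasurable (fun k => g (p - k)) := fun p =>
    hgm.comp_quasiMeasurePreserving (quasiMeasurePreserving_sub_left volume p)
  have hmsub : ∀ p, Measurable fun k => m k (p - k) := fun p =>
    hmm.comp (measurable_id.prodMk (measurable_const.sub measurable_id))
  have hhold : ∀ p, 0 < spNorm p → ∫⁻ k, ‖bilinIntegrand m F G p k‖ₑ ≤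
      A ^ (1 / r) * (∫⁻ k, f k ^ q * g (p - k) ^ q) ^ (1 / q) := by
    intro p hp
    have hK : Measurable fun k => ENNReal.ofReal (holderKernel m α₁ α₂ b σ₁ σ₂ p k) := by
      have := hmsub p
      unfold holderKernel
      fun_prop
    have h := ENNReal.lintegral_mul_le_Lp_mul_Lq volume hconj hK.aemeasurable
      (hfm.mul (hgsub p))
    calc _ = _ := lintegral_congr fun k => enorm_bilinIntegrand m α₁ α₂ b σ₁ σ₂ F G p k
      _ ≤ _ := h
      _ ≤ _ := by
        gcongr with k
        · exact hker σ₁ σ₂ m hm p hp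
        · exact (ENNReal.mul_rpow_of_nonneg _ _ hq0.le).le
  have hton := lintegral_lintegral_mul_comp_sub (hfm.pow_const q) (hgm.pow_const q)
  constructor
  · intro hFt hGt
    rw [hfn, ENNReal.rpow_lt_top_iff_of_pos (by positivity)] at hFt
    rw [hgn, ENNReal.rpow_lt_top_iff_of_pos (by positivity)] at hGt
    have hfin : ∀ᵐ p, ∫⁻ k, f k ^ q * g (p - k) ^ q < ∞ := by
      refine ae_lt_top' (aemeasurable_mul_comp_sub (hfm.pow_const q)
        (hgm.pow_const q)).lintegral_prod_right' ?_
      rw [hton]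
      exact (ENNReal.mul_lt_top hFt hGt).ne
    filter_upwards [hfin, ae_spNorm_pos] with p hp hp0
    refine ⟨?_, ?_⟩
    · exact ((hmsub p).aestronglyMeasurable.mul hF).mul
        (hG.comp_quasiMeasurePreserving (quasiMeasurePreserving_sub_left volume p))
    · refine lt_of_le_of_lt (hhold p hp0) (ENNReal.mul_lt_top hAr.lt_top ?_)
      exact ENNReal.rpow_lt_top_of_nonneg (by positivity) hp.ne
  · have hpt : ∀ᵐ p, ‖(hWeight 0 0 p : ℂ) * bilinHat m F G p‖ₑ ^ q ≤
        (A ^ (1 / r)) ^ q * ∫⁻ k, f k ^ q * g (p - k) ^ q := by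
      filter_upwards [ae_spNorm_pos] with p hp
      have hc : ‖((((2 * Real.pi) ^ 3)⁻¹ : ℝ) : ℂ)‖ₑ ≤ 1 := by
        rw [← ofReal_norm, ENNReal.ofReal_le_one, Complex.norm_real,
          Real.norm_eq_abs, abs_of_pos (by positivity)]
        exact inv_le_one_of_one_le₀ (one_le_pow₀ (by linarith [Real.pi_gt_three]))
      rw [hWeight_zero_zero, Complex.ofReal_one, one_mul, bilinHat, enorm_mul]
      calc _ ≤ (1 * (A ^ (1 / r) * (∫⁻ k, f k ^ q * g (p - k) ^ q) ^ (1 / q))) ^ q := by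
            gcongr
            exact (enorm_integral_le_lintegral_enorm _).trans (hhold p hp)
        _ = _ := by
            rw [one_mul, ENNReal.mul_rpow_of_nonneg _ _ hq0.le,
              ← ENNReal.rpow_mul (lintegral _ _), one_div_mul_cancel hq0.ne', ENNReal.rpow_one]
    rw [hHatNorm, eLpNorm_eq_lintegral_rpow_enorm_toReal hd0 hdt, hdr, hfn, hgn]
    calc _ ≤ ((A ^ (1 / r)) ^ q * ((∫⁻ k, f k ^ q) * ∫⁻ k, g k ^ q)) ^ (1 / q) := by
          gcongr
          refine (lintegral_mono_ae hpt).trans (le_of_eq ?_)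
          rw [lintegral_const_mul' _ _ (ENNReal.rpow_ne_top_of_nonneg hq0.le hAr), hton]
      _ = _ := by
          rw [ENNReal.mul_rpow_of_nonneg _ _ (by positivity),
            ENNReal.mul_rpow_of_nonneg _ _ (by positivity), ← ENNReal.rpow_mul,
            mul_one_div_cancel hq0.ne', ENNReal.rpow_one, mul_assoc]

/-! ### Bounds for the symbols -/

theorem angDefect_eq (κ : ℝ) {k l : SpaceTime} (hk : spNorm k ≠ 0) (hl : spNorm l ≠ 0) :
    angDefect κ k l = 1 - κ * (k 1 / spNorm k * (l 1 / spNorm l) +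
      k 2 / spNorm k * (l 2 / spNorm l)) := by
  rw [angDefect]; field_simp

theorem div_spNorm_sq_add {k : SpaceTime} (hk : spNorm k ≠ 0) :
    (k 1 / spNorm k) ^ 2 + (k 2 / spNorm k) ^ 2 = 1 := by
  rw [div_pow, div_pow, ← add_div, ← spNorm_sq, div_self (by positivity)]

/-- The symbol is, up to sign, the sine of the angle. With c its cosine, 2(1 - κc) - (1 - c²) = (c -
κ)² ≥ 0. Where a spatial part vanishes, division by zero makes the symbol 0 and the defect 1. -/
theorem norm_q12Symbol_sq_le {κ : ℝ} (hκ : κ = 1 ∨ κ = -1) (k l : SpaceTime) :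
    ‖q12Symbol k l‖ ^ 2 ≤ 2 * angDefect κ k l := by
  rcases eq_or_ne (spNorm k) 0 with hk | hk
  · simp [q12Symbol, angDefect, hk]
  rcases eq_or_ne (spNorm l) 0 with hl | hl
  · simp [q12Symbol, angDefect, hl]
  have hq : q12Symbol k l = ((-(k 1 / spNorm k * (l 2 / spNorm l) -
      k 2 / spNorm k * (l 1 / spNorm l)) : ℝ) : ℂ) := by
    have hk' : (spNorm k : ℂ) ≠ 0 := by exact_mod_cast hk
    have hl' : (spNorm l : ℂ) ≠ 0 := by exact_mod_cast hl
    simp only [q12Symbol]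
    push_cast
    field_simp
    linear_combination ((k 1 : ℂ) * l 2 - k 2 * l 1) * Complex.I_sq
  rw [hq, Complex.norm_real, Real.norm_eq_abs, sq_abs, angDefect_eq κ hk hl]
  have e1 := div_spNorm_sq_add hk
  have e2 := div_spNorm_sq_add hl
  set x := k 1 / spNorm k
  set y := k 2 / spNorm k
  set z := l 1 / spNorm l
  set w := l 2 / spNorm l
  have e3 : (x * w - y * z) ^ 2 + (x * z + y * w) ^ 2 = 1 := by
    linear_combination (z ^ 2 + w ^ 2) * e1 + e2
  rcases hκ with rfl | rfl
  · nlinarith [sq_nonneg (x * z + y * w - 1)]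
  · nlinarith [sq_nonneg (x * z + y * w + 1)]

/-- The symbol is the j-th component of the difference σ₁ζ/|ζ| - σ₂η/|η| of unit vectors, whose
squared length equals twice the defect. -/
theorem norm_q0Symbol_sq_le (σ₁ σ₂ : ℤˣ) (j : Fin 2) (k l : SpaceTime) :
    ‖q0Symbol σ₁ σ₂ j k l‖ ^ 2 ≤ 2 * angDefect (sgn σ₁ * sgn σ₂) k l := by
  rcases eq_or_ne (spNorm k) 0 with hk | hk
  · simp [q0Symbol, angDefect, hk]
  rcases eq_or_ne (spNorm l) 0 with hl | hl
  · simp [q0Symbol, angDefect, hl]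
  have hq : q0Symbol σ₁ σ₂ j k l = ((sgn σ₁ * (l j.succ / spNorm l) -
      sgn σ₂ * (k j.succ / spNorm k) : ℝ) : ℂ) := by
    have hk' : (spNorm k : ℂ) ≠ 0 := by exact_mod_cast hk
    have hl' : (spNorm l : ℂ) ≠ 0 := by exact_mod_cast hl
    simp only [q0Symbol, dtSymbol]
    push_cast
    field_simp
    linear_combination (-(sgn σ₁ : ℂ) * spNorm k * l j.succ + k j.succ * sgn σ₂ * spNorm l)
      * Complex.I_sq
  rw [hq, Complex.norm_real, Real.norm_eq_abs, sq_abs, angDefect_eq _ hk hl]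
  have e1 := div_spNorm_sq_add hk
  have e2 := div_spNorm_sq_add hl
  have s1 : sgn σ₁ ^ 2 = 1 := by rcases sgn_eq σ₁ with h | h <;> rw [h] <;> norm_num
  have s2 : sgn σ₂ ^ 2 = 1 := by rcases sgn_eq σ₂ with h | h <;> rw [h] <;> norm_num
  have key : (sgn σ₁ * (l 1 / spNorm l) - sgn σ₂ * (k 1 / spNorm k)) ^ 2 +
      (sgn σ₁ * (l 2 / spNorm l) - sgn σ₂ * (k 2 / spNorm k)) ^ 2 =
      2 * (1 - sgn σ₁ * sgn σ₂ * (k 1 / spNorm k * (l 1 / spNorm l) +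
      k 2 / spNorm k * (l 2 / spNorm l))) := by
    linear_combination ((l 1 / spNorm l) ^ 2 + (l 2 / spNorm l) ^ 2) * s1 +
      ((k 1 / spNorm k) ^ 2 + (k 2 / spNorm k) ^ 2) * s2 + e1 + e2
  rw [← key]
  fin_cases j
  · exact le_add_of_nonneg_right (sq_nonneg _)
  · exact le_add_of_nonneg_left (sq_nonneg _)

theorem measurable_q12Symbol :
    Measurable fun q : SpaceTime × SpaceTime => q12Symbol q.1 q.2 := by
  unfold q12Symbol; fun_prop

theorem measurable_q0Symbol (σ₁ σ₂ : ℤˣ) (j : Fin 2) :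
    Measurable fun q : SpaceTime × SpaceTime => q0Symbol σ₁ σ₂ j q.1 q.2 := by
  unfold q0Symbol dtSymbol; fun_prop

/-! ### The Fourier transform of a product -/

section Plancherel

variable {V : Type*} [NormedAddCommGroup V] [InnerProductSpace ℝ V] [FiniteDimensional ℝ V]
  [MeasurableSpace V] [BorelSpace V]

theorem integral_fourierInv_mul_eq {f g : V → ℂ} (hf : Integrable f) (hg : Integrable g) :
    ∫ x, 𝓕⁻ f x * g x = ∫ x, f x * 𝓕⁻ g x := by
  have h := VectorFourier.integral_fourierIntegral_smul_eq_flip (μ := (volume : Measure V))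
    (ν := (volume : Measure V)) (L := -innerₗ V) Real.continuous_fourierChar
    (by simpa using (by fun_prop : Continuous fun p : V × V => -inner ℝ p.1 p.2)) hf hg
  have hflip : (-innerₗ V).flip = -innerₗ V := by
    ext x y; simp [real_inner_comm]
  rw [hflip] at h
  exact h

/-- Identifies the integral transform with the L² extension, so that Plancherel applies to
integrals. Both sides agree when tested against smooth compactly supported functions, by the
multiplication formula on one side and the distributional transform on the other. -/
theorem fourierInv_ae_eq_of_memLp {h : V → ℂ} (h1 : Integrable h) (h2 : MemLp h 2) :
    𝓕⁻ h =ᵐ[volume] (𝓕⁻ (h2.toLp h) : Lp ℂ 2 (volume : Measure V)) := by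
  have hcont : Continuous (𝓕⁻ h) := by
    have := VectorFourier.fourierIntegral_continuous (μ := (volume : Measure V))
      (L := -innerₗ V) Real.continuous_fourierChar (by simpa using (by fun_prop : Continuous fun p : V × V => -inner ℝ p.1 p.2)) h1
    exact this
  refine ae_eq_of_integral_contDiff_smul_eq hcont.locallyIntegrable
    ((Lp.memLp _).locallyIntegrable (by norm_num)) fun g hg hgs => ?_
  have hgs' : HasCompactSupport (fun x => (g x : ℂ)) := hgs.comp_left Complex.ofReal_zero
  have hg' : ContDiff ℝ ((⊤ : ℕ∞) : WithTop ℕ∞) (fun x => (g x : ℂ)) := Complex.ofRealCLM.contDiff.comp hg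
  set φ : 𝓢(V, ℂ) := hgs'.toSchwartzMap hg' with hφ
  have hφg : ∀ x, φ x = (g x : ℂ) := fun x => rfl
  have e := congrArg (fun T => T φ) (Lp.fourierInv_toTemperedDistribution_eq (h2.toLp h))
  simp only [TemperedDistribution.fourierInv_apply, Lp.toTemperedDistribution_apply] at e
  have e1 : ∫ x, (𝓕⁻ φ) x • (h2.toLp h) x = ∫ x, 𝓕⁻ (φ : V → ℂ) x * h x := by
    refine integral_congr_ae ?_
    filter_upwards [h2.coeFn_toLp] with x hx
    rw [hx, SchwartzMap.fourierInv_coe, smul_eq_mul]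
  rw [e1, integral_fourierInv_mul_eq φ.integrable h1] at e
  simp only [hφg] at e
  simpa [Complex.real_smul] using e

theorem memLp_fourierInv {h : V → ℂ} (h1 : Integrable h) (h2 : MemLp h 2) :
    MemLp (𝓕⁻ h) 2 :=
  (memLp_congr_ae (fourierInv_ae_eq_of_memLp h1 h2)).2 (Lp.memLp _)

theorem integral_inner_fourierInv {g h : V → ℂ} (g1 : Integrable g) (g2 : MemLp g 2)
    (h1 : Integrable h) (h2 : MemLp h 2) :
    ∫ x, inner ℂ (𝓕⁻ g x) (𝓕⁻ h x) = ∫ x, inner ℂ (g x) (h x) := by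
  have e := (Lp.fourierTransformₗᵢ V ℂ).symm.inner_map_map (g2.toLp g) (h2.toLp h)
  rw [L2.inner_def, L2.inner_def] at e
  calc _ = _ := integral_congr_ae ?_
    _ = _ := e
    _ = _ := integral_congr_ae ?_
  · filter_upwards [fourierInv_ae_eq_of_memLp g1 g2, fourierInv_ae_eq_of_memLp h1 h2]
      with x hx hy
    rw [hx, hy]; rfl
  · filter_upwards [g2.coeFn_toLp, h2.coeFn_toLp] with x hx hy
    rw [hx, hy]

theorem integrable_fourierInv_mul {g h : V → ℂ} (g1 : Integrable g) (g2 : MemLp g 2)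
    (h1 : Integrable h) (h2 : MemLp h 2) : Integrable (fun x => 𝓕⁻ g x * 𝓕⁻ h x) :=
  (memLp_fourierInv g1 g2).integrable_mul (memLp_fourierInv h1 h2)

/-- Parseval for g and the conjugated reflection k ↦ conj h(x - k): the inverse transform of the
latter is the conjugate of that of h times the character at x. -/
theorem fourier_fourierInv_mul {g h : V → ℂ} (g1 : Integrable g) (g2 : MemLp g 2)
    (h1 : Integrable h) (h2 : MemLp h 2) (x : V) :
    𝓕 (fun y => 𝓕⁻ g y * 𝓕⁻ h y) x = ∫ k, g k * h (x - k) := by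
  set G : V → ℂ := fun k => starRingEnd ℂ (h (x - k)) with hG
  have hsub := Measure.measurePreserving_sub_left (volume : Measure V) x
  have G1 : Integrable G := by
    have := h1.comp_sub_left x
    exact (LinearIsometryEquiv.integrable_comp_iff Complex.conjLIE).2 this
  have G2 : MemLp G 2 := (h2.comp_measurePreserving hsub).star
  have key : ∀ y, 𝓕⁻ G y = starRingEnd ℂ (Real.fourierChar (-inner ℝ y x) • 𝓕⁻ h y) := by
    intro y
    rw [Real.fourierInv_eq, Real.fourierInv_eq, Circle.smul_def, smul_eq_mul, map_mul,
      ← integral_conj, ← integral_sub_left_eq_self _ _ x, ← integral_const_mul]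
    refine integral_congr_ae (Filter.Eventually.of_forall fun k => ?_)
    simp only [hG, Circle.smul_def, smul_eq_mul, map_mul, sub_sub_cancel, inner_sub_left]
    rw [← mul_assoc]
    congr 1
    rw [← Circle.coe_inv_eq_conj, ← Circle.coe_inv_eq_conj, ← Circle.coe_mul,
      ← AddChar.map_neg_eq_inv, ← AddChar.map_neg_eq_inv, ← AddChar.map_add_eq_mul,
      real_inner_comm]
    congr 2; ring
  have e := integral_inner_fourierInv G1 G2 g1 g2
  rw [Real.fourier_eq]
  calc _ = ∫ y, inner ℂ (𝓕⁻ G y) (𝓕⁻ g y) := by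
        refine integral_congr_ae (Filter.Eventually.of_forall fun y => ?_)
        simp only [key, RCLike.inner_apply, Complex.conj_conj, Circle.smul_def, smul_eq_mul]
        ring
    _ = _ := e
    _ = _ := by
        refine integral_congr_ae (Filter.Eventually.of_forall fun y => ?_)
        simp only [hG, RCLike.inner_apply, Complex.conj_conj]

/-- Differentiation under the integral sign in the inverse Fourier transform. -/
theorem fderiv_fourierInv_apply {f : V → ℂ} (hf : Integrable f)
    (hf' : Integrable fun v => ‖v‖ * ‖f v‖) (x y : V) :
    fderiv ℝ (𝓕⁻ f) x y =
      𝓕⁻ (fun k => (Complex.I * (2 * Real.pi * inner ℝ k y : ℝ)) * f k) x := by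
  have hd := Real.hasFDerivAt_fourier hf hf' (-x)
  have hn : HasFDerivAt (fun x : V => -x) (-ContinuousLinearMap.id ℝ V) x :=
    (hasFDerivAt_id x).neg
  have hc := (hd.comp x hn).congr_of_eventuallyEq (f₁ := 𝓕⁻ f)
    (Filter.Eventually.of_forall fun z => Real.fourierInv_eq_fourier_neg f z)
  rw [hc.fderiv]
  have hi : Integrable (VectorFourier.fourierSMulRight (innerSL ℝ) f) := by
    refine (hf'.const_mul (2 * Real.pi)).mono'
      (hf.aestronglyMeasurable.fourierSMulRight) ?_
    filter_upwards with v
    rw [VectorFourier.norm_fourierSMulRight, innerSL_apply_norm, mul_assoc]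
  rw [ContinuousLinearMap.comp_apply, Real.fourierInv_eq_fourier_neg]
  simp only [neg_apply, ContinuousLinearMap.id_apply, map_neg]
  rw [Real.fourier_continuousLinearMap_apply hi, Real.fourier_eq, Real.fourier_eq,
    ← integral_neg]
  refine integral_congr_ae (Filter.Eventually.of_forall fun k => ?_)
  simp only [VectorFourier.fourierSMulRight_apply, Circle.smul_def,
    smul_eq_mul, Complex.real_smul]
  erw [innerSL_apply_apply]
  push_cast
  ring

end Plancherel

/-! ### The null forms of Schwartz functions -/

theorem spNorm_smul {c : ℝ} (hc : 0 ≤ c) (k : SpaceTime) : spNorm (c • k) = c * spNorm k := by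
  simp only [spNorm, PiLp.smul_apply, smul_eq_mul]
  rw [show (c * k 1) ^ 2 + (c * k 2) ^ 2 = c ^ 2 * (k 1 ^ 2 + k 2 ^ 2) by ring,
    Real.sqrt_mul (by positivity), Real.sqrt_sq hc]

theorem norm_sq_eq_add_spNorm_sq (k : SpaceTime) : ‖k‖ ^ 2 = k 0 ^ 2 + spNorm k ^ 2 := by
  rw [EuclideanSpace.norm_sq_eq, spNorm_sq, Fin.sum_univ_three]
  simp only [Real.norm_eq_abs, sq_abs]; ring

/-- The singularity |ξ|⁻¹ is absorbed by the polar Jacobian in the plane. -/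
theorem lintegral_inv_spNorm_decay_lt_top :
    ∫⁻ k : SpaceTime, ENNReal.ofReal ((spNorm k)⁻¹ * ((1 + k 0 ^ 2)⁻¹ * (1 + spNorm k ^ 2)⁻¹))
      < ∞ := by
  rw [lintegral_polar (by fun_prop)]
  have hpt : ∀ τ θ s : ℝ, s ∈ Set.Ioi (0 : ℝ) →
      ENNReal.ofReal s * ENNReal.ofReal
        ((spNorm !₂[τ, s * Real.cos θ, s * Real.sin θ])⁻¹ *
          ((1 + (!₂[τ, s * Real.cos θ, s * Real.sin θ] : SpaceTime) 0 ^ 2)⁻¹ *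
            (1 + spNorm !₂[τ, s * Real.cos θ, s * Real.sin θ] ^ 2)⁻¹)) =
      ENNReal.ofReal (1 + τ ^ 2)⁻¹ * ENNReal.ofReal (1 + s ^ 2)⁻¹ := by
    intro τ θ s hs
    have hs : 0 < s := hs
    have hn := spNorm_polar τ θ hs.le
    rw [hn, show (!₂[τ, s * Real.cos θ, s * Real.sin θ] : SpaceTime) 0 = τ from rfl,
      ← ENNReal.ofReal_mul hs.le, ← ENNReal.ofReal_mul (by positivity)]
    congr 1; field_simp
  have hfin : ∫⁻ t : ℝ, ENNReal.ofReal (1 + t ^ 2)⁻¹ < ∞ :=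
    integrable_inv_one_add_sq.lintegral_lt_top
  calc _ = ∫⁻ τ : ℝ, ∫⁻ θ in Set.Ioc (-Real.pi) Real.pi, ∫⁻ s in Set.Ioi (0 : ℝ),
        ENNReal.ofReal (1 + τ ^ 2)⁻¹ * ENNReal.ofReal (1 + s ^ 2)⁻¹ :=
        lintegral_congr fun τ => lintegral_congr fun θ =>
          setLIntegral_congr_fun measurableSet_Ioi fun s hs => hpt τ θ s hs
    _ ≤ ∫⁻ τ : ℝ, ENNReal.ofReal (1 + τ ^ 2)⁻¹ *
        ((∫⁻ t : ℝ, ENNReal.ofReal (1 + t ^ 2)⁻¹) * volume (Set.Ioc (-Real.pi) Real.pi)) := by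
        refine lintegral_mono fun τ => ?_
        rw [← mul_assoc, ← setLIntegral_const]
        refine lintegral_mono fun θ => ?_
        rw [lintegral_const_mul _ (by fun_prop)]
        gcongr
        exact Measure.restrict_le_self
    _ < ∞ := by
        rw [lintegral_mul_const _ (by fun_prop)]
        refine ENNReal.mul_lt_top hfin (ENNReal.mul_lt_top hfin ?_)
        rw [Real.volume_Ioc]; exact ENNReal.ofReal_lt_top

theorem integrable_inv_spNorm_mul (φ : 𝓢(SpaceTime, ℂ)) :
    Integrable fun k => (spNorm k)⁻¹ * ((1 + ‖k‖) * ‖φ k‖) := by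
  -- Five powers of 1 + |k|: four dominate (1 + τ²)(1 + |ξ|²), one pays for the weight in the
  -- statement.
  have hd := SchwartzMap.one_add_le_sup_seminorm_apply (𝕜 := ℝ) (m := (5, 0)) le_rfl le_rfl φ
  set C := 2 ^ 5 * ((Finset.Iic (5, 0)).sup fun m => SchwartzMap.seminorm ℝ m.1 m.2) φ with hC
  have hw : Integrable fun k : SpaceTime =>
      (spNorm k)⁻¹ * ((1 + k 0 ^ 2)⁻¹ * (1 + spNorm k ^ 2)⁻¹) := by
    refine ⟨(show Measurable _ by fun_prop).aestronglyMeasurable, ?_⟩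
    rw [hasFiniteIntegral_iff_ofReal (Filter.Eventually.of_forall fun k => by
      have := spNorm_nonneg k; positivity)]
    exact lintegral_inv_spNorm_decay_lt_top
  refine (hw.const_mul C).mono' ?_ (Filter.Eventually.of_forall fun k => ?_)
  · have := φ.continuous.measurable
    exact (show Measurable _ by fun_prop).aestronglyMeasurable
  · have h0 := spNorm_nonneg k
    rw [Real.norm_of_nonneg (by positivity)]
    have hk := hd k
    rw [norm_iteratedFDeriv_zero] at hk
    have hle : (1 + k 0 ^ 2) * (1 + spNorm k ^ 2) ≤ (1 + ‖k‖) ^ 4 := by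
      have e := norm_sq_eq_add_spNorm_sq k
      have h1 : 1 + k 0 ^ 2 ≤ (1 + ‖k‖) ^ 2 := by nlinarith [norm_nonneg k, sq_nonneg (spNorm k)]
      have h2 : 1 + spNorm k ^ 2 ≤ (1 + ‖k‖) ^ 2 := by nlinarith [norm_nonneg k, sq_nonneg (k 0)]
      calc _ ≤ (1 + ‖k‖) ^ 2 * (1 + ‖k‖) ^ 2 := by gcongr
        _ = _ := by ring
    have hb : (1 + ‖k‖) * ‖φ k‖ ≤ C * ((1 + k 0 ^ 2)⁻¹ * (1 + spNorm k ^ 2)⁻¹) := by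
      rw [← mul_inv, ← div_eq_mul_inv, le_div_iff₀ (by positivity)]
      calc _ ≤ (1 + ‖k‖) * ‖φ k‖ * (1 + ‖k‖) ^ 4 := by gcongr
        _ = (1 + ‖k‖) ^ 5 * ‖φ k‖ := by ring
        _ ≤ C := hk
    calc _ ≤ (spNorm k)⁻¹ * (C * ((1 + k 0 ^ 2)⁻¹ * (1 + spNorm k ^ 2)⁻¹)) := by gcongr
      _ = _ := by ring

/-- The symbol `i ξ_j |ξ|⁻¹` of `∂_j |∇|⁻¹`. -/
def rieszSymbol (j : Fin 3) (p : SpaceTime) : ℂ := Complex.I * p j * (spNorm p : ℂ)⁻¹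

/-- The transform of |∇|⁻¹u is singular at ξ = 0, but it and its product with |k| are integrable,
which is what differentiation under the integral requires. -/
theorem pd_invGrad (u : 𝓢(SpaceTime, ℂ)) (j : Fin 3) (x : SpaceTime) :
    pd j (invGrad u) x = multiplier (rieszSymbol j) u x := by
  set f : SpaceTime → ℂ := fun k => ((spNorm ((2 * Real.pi) • k) : ℂ)⁻¹) * 𝓕 (u : SpaceTime → ℂ) k
    with hf
  have hi := integrable_inv_spNorm_mul (𝓕 u)
  have hnorm : ∀ k, ‖f k‖ = (2 * Real.pi)⁻¹ * ((spNorm k)⁻¹ * ‖(𝓕 u) k‖) := by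
    intro k
    have h0 := spNorm_nonneg k
    simp only [hf]
    rw [norm_mul, norm_inv, Complex.norm_real, spNorm_smul (by positivity), Real.norm_eq_abs,
      abs_of_nonneg (by positivity), SchwartzMap.fourier_coe, mul_inv, mul_assoc]
  have hfm : AEStronglyMeasurable f := by
    have h1 : Measurable fun k : SpaceTime => ((spNorm ((2 * Real.pi) • k) : ℂ)⁻¹) := by fun_prop
    have h2 := (𝓕 u).continuous
    rw [SchwartzMap.fourier_coe] at h2
    exact (h1.mul h2.measurable).aestronglyMeasurable
  have hf1 : Integrable f := by
    refine (hi.const_mul (2 * Real.pi)⁻¹).mono' hfm (Filter.Eventually.of_forall fun k => ?_)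
    have h0 := spNorm_nonneg k
    rw [hnorm]
    gcongr
    exact le_mul_of_one_le_left (norm_nonneg _) (by linarith [norm_nonneg k])
  have hf2 : Integrable fun k => ‖k‖ * ‖f k‖ := by
    refine (hi.const_mul (2 * Real.pi)⁻¹).mono' (continuous_norm.aestronglyMeasurable.mul hfm.norm)
      (Filter.Eventually.of_forall fun k => ?_)
    have h0 := spNorm_nonneg k
    rw [Real.norm_of_nonneg (by positivity), hnorm]
    calc _ = (2 * Real.pi)⁻¹ * ((spNorm k)⁻¹ * (‖k‖ * ‖(𝓕 u) k‖)) := by ring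
      _ ≤ _ := by gcongr; linarith
  rw [pd, show invGrad u = 𝓕⁻ f from rfl, fderiv_fourierInv_apply hf1 hf2, multiplier]
  refine congrArg (fun F : SpaceTime → ℂ => 𝓕⁻ F x) (funext fun k => ?_)
  simp only [hf, rieszSymbol, EuclideanSpace.inner_single_right, PiLp.smul_apply, smul_eq_mul,
    one_mul, conj_trivial]
  push_cast
  ring

theorem norm_rieszSymbol_le (j : Fin 2) (p : SpaceTime) : ‖rieszSymbol j.succ p‖ ≤ 1 := by
  rw [rieszSymbol, norm_mul, norm_mul, Complex.norm_I, one_mul, norm_inv, Complex.norm_real,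
    Complex.norm_real, Real.norm_of_nonneg (spNorm_nonneg p), ← div_eq_mul_inv]
  refine div_le_one_of_le₀ (Real.abs_le_sqrt ?_) (spNorm_nonneg p)
  fin_cases j
  · exact le_add_of_nonneg_right (sq_nonneg _)
  · exact le_add_of_nonneg_left (sq_nonneg _)

theorem measurable_rieszSymbol (j : Fin 3) : Measurable (rieszSymbol j) := by
  unfold rieszSymbol; fun_prop

theorem norm_dtSymbol_mul_inv_le (σ : ℤˣ) (p : SpaceTime) :
    ‖dtSymbol σ p * ((spNorm p)⁻¹ : ℂ)‖ ≤ 1 := by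
  have hs : |sgn σ| = 1 := by rcases sgn_eq σ with h | h <;> rw [h] <;> simp
  rw [dtSymbol, norm_mul, norm_mul, norm_neg, Complex.norm_I, one_mul, norm_inv, Complex.norm_real,
    Complex.norm_real, Real.norm_of_nonneg (spNorm_nonneg p), Real.norm_eq_abs, abs_mul, hs,
    one_mul, abs_of_nonneg (spNorm_nonneg p)]
  exact mul_inv_le_one

theorem measurable_dtSymbol_mul_inv (σ : ℤˣ) :
    Measurable fun p => dtSymbol σ p * ((spNorm p)⁻¹ : ℂ) := by
  unfold dtSymbol; fun_prop

theorem ft_eq_fourier (u : 𝓢(SpaceTime, ℂ)) (p : SpaceTime) :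
    ft u p = (𝓕 u) ((2 * Real.pi)⁻¹ • p) := by
  rw [ft, SchwartzMap.fourier_coe]

theorem integrable_ft (u : 𝓢(SpaceTime, ℂ)) : Integrable (ft u) := by
  have := (𝓕 u).integrable (μ := volume)
  have h2 := this.comp_smul (R := (2 * Real.pi)⁻¹) (by positivity)
  exact h2.congr (Filter.Eventually.of_forall fun p => (ft_eq_fourier u p).symm)

theorem continuous_ft (u : 𝓢(SpaceTime, ℂ)) : Continuous (ft u) := by
  rw [show ft u = fun p => (𝓕 u) ((2 * Real.pi)⁻¹ • p) from funext (ft_eq_fourier u)]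
  have := (𝓕 u).continuous
  fun_prop

theorem integrable_bilinIntegrand_ft {a c : SpaceTime → ℂ} (ha : Measurable a)
    (hc : Measurable c) (ha1 : ∀ p, ‖a p‖ ≤ 1) (hc1 : ∀ p, ‖c p‖ ≤ 1) (u v : 𝓢(SpaceTime, ℂ))
    (p : SpaceTime) :
    Integrable (bilinIntegrand (fun k l => a k * c l) (ft u) (ft v) p) := by
  have hu := integrable_ft u
  have hcv := (continuous_ft v).measurable
  have hm : AEStronglyMeasurable (fun k => a k * c (p - k) * ft v (p - k)) volume :=
    (show Measurable _ by fun_prop).aestronglyMeasurable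
  obtain ⟨C, hC⟩ : ∃ C, ∀ q, ‖ft v q‖ ≤ C := by
    refine ⟨SchwartzMap.seminorm ℝ 0 0 (𝓕 v), fun q => ?_⟩
    rw [ft_eq_fourier]
    exact SchwartzMap.norm_le_seminorm ℝ _ _
  have := hu.bdd_mul (c := C) hm (Filter.Eventually.of_forall fun k => by
    rw [norm_mul, norm_mul]
    calc _ ≤ 1 * 1 * C := by
          gcongr
          · exact ha1 _
          · exact hc1 _
          · exact hC _
      _ = C := by ring)
  refine this.congr (Filter.Eventually.of_forall fun k => ?_)
  simp only [bilinIntegrand]; ring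

/-- Bounded symbols keep the transforms in L¹ ∩ L²; hence both factors are in L² and their product
is integrable. -/
theorem multiplier_mul_multiplier {a c : SpaceTime → ℂ} (ha : Measurable a)
    (hc : Measurable c) (ha1 : ∀ p, ‖a p‖ ≤ 1) (hc1 : ∀ p, ‖c p‖ ≤ 1) (u v : 𝓢(SpaceTime, ℂ)) :
    Integrable (fun x => multiplier a u x * multiplier c v x) ∧
      ft (fun x => multiplier a u x * multiplier c v x) =
        bilinHat (fun k l => a k * c l) (ft u) (ft v) := by
  have hL : ∀ {a : SpaceTime → ℂ}, Measurable a → (∀ p, ‖a p‖ ≤ 1) → ∀ (u : 𝓢(SpaceTime, ℂ))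
      {q : ℝ≥0∞}, MemLp (fun k : SpaceTime => a ((2 * Real.pi) • k) *
        𝓕 (u : SpaceTime → ℂ) k) q := by
    intro a ha ha1 u q
    have hu := (𝓕 u).memLp q volume
    have hcu := (𝓕 u).continuous.measurable
    rw [SchwartzMap.fourier_coe] at hu hcu
    refine hu.mono (show Measurable _ by fun_prop).aestronglyMeasurable
      (Filter.Eventually.of_forall fun k => ?_)
    rw [norm_mul]
    exact mul_le_of_le_one_left (norm_nonneg _) (ha1 _)
  have g1 := memLp_one_iff_integrable.1 (hL ha ha1 u)
  have h1 := memLp_one_iff_integrable.1 (hL hc hc1 v)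
  refine ⟨integrable_fourierInv_mul g1 (hL ha ha1 u) h1 (hL hc hc1 v), ?_⟩
  ext p
  have hpi : (0 : ℝ) < 2 * Real.pi := by positivity
  have e := fourier_fourierInv_mul g1 (hL ha ha1 u) h1 (hL hc hc1 v) ((2 * Real.pi)⁻¹ • p)
  -- Rescaling frequencies by 2π in dimension 3 produces the factor (2π)⁻³ of `bilinHat`.
  have hsc := Measure.integral_comp_smul (volume : Measure SpaceTime)
    (fun k => bilinIntegrand (fun k l => a k * c l) (ft u) (ft v) p k) (2 * Real.pi)
  have hfr : Module.finrank ℝ SpaceTime = 3 := finrank_euclideanSpace_fin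
  rw [hfr, abs_of_pos (by positivity), Complex.real_smul] at hsc
  rw [ft, bilinHat, ← hsc]
  refine e.trans (integral_congr_ae (Filter.Eventually.of_forall fun k => ?_))
  have e1 : (2 * Real.pi) • ((2 * Real.pi)⁻¹ • p - k) = p - (2 * Real.pi) • k := by
    rw [smul_sub, smul_inv_smul₀ hpi.ne']
  have e2 : (2 * Real.pi)⁻¹ • (p - (2 * Real.pi) • k) = (2 * Real.pi)⁻¹ • p - k := by
    rw [smul_sub, inv_smul_smul₀ hpi.ne']
  simp only [bilinIntegrand, ft, e1, e2, inv_smul_smul₀ hpi.ne']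
  ring

theorem ft_sub {f g : SpaceTime → ℂ} (hf : Integrable f) (hg : Integrable g) :
    ft (fun x => f x - g x) = fun p => ft f p - ft g p := by
  ext p
  simp only [ft, Real.fourier_eq]
  rw [← integral_sub ((Real.fourierIntegral_convergent_iff _).2 hf)
    ((Real.fourierIntegral_convergent_iff _).2 hg)]
  simp only [smul_sub]

theorem nullForm_ft {a c a' c' : SpaceTime → ℂ} (ha : Measurable a) (hc : Measurable c)
    (ha' : Measurable a') (hc' : Measurable c') (ha1 : ∀ p, ‖a p‖ ≤ 1) (hc1 : ∀ p, ‖c p‖ ≤ 1)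
    (ha1' : ∀ p, ‖a' p‖ ≤ 1) (hc1' : ∀ p, ‖c' p‖ ≤ 1) (u v : 𝓢(SpaceTime, ℂ)) :
    Integrable (fun x => multiplier a u x * multiplier c v x -
        multiplier a' u x * multiplier c' v x) ∧
      ft (fun x => multiplier a u x * multiplier c v x -
        multiplier a' u x * multiplier c' v x) =
        bilinHat (fun k l => a k * c l - a' k * c' l) (ft u) (ft v) := by
  obtain ⟨i1, e1⟩ := multiplier_mul_multiplier ha hc ha1 hc1 u v
  obtain ⟨i2, e2⟩ := multiplier_mul_multiplier ha' hc' ha1' hc1' u v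
  refine ⟨i1.sub i2, ?_⟩
  rw [ft_sub i1 i2, e1, e2]
  ext p
  simp only [bilinHat]
  rw [← mul_sub, ← integral_sub (integrable_bilinIntegrand_ft ha hc ha1 hc1 u v p)
    (integrable_bilinIntegrand_ft ha' hc' ha1' hc1' u v p)]
  congr 2
  ext k
  simp only [bilinIntegrand]; ring

theorem q12_schwartz (u v : 𝓢(SpaceTime, ℂ)) :
    Integrable (q12 u v) ∧ ft (q12 u v) = bilinHat q12Symbol (ft u) (ft v) := by
  have hm := measurable_rieszSymbol
  have h1 : ∀ p, ‖rieszSymbol 1 p‖ ≤ 1 := norm_rieszSymbol_le 0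
  have h2 : ∀ p, ‖rieszSymbol 2 p‖ ≤ 1 := norm_rieszSymbol_le 1
  have key := nullForm_ft (hm 1) (hm 2) (hm 2) (hm 1) h1 h2 h2 h1 u v
  have hq : q12 u v = fun x => multiplier (rieszSymbol 1) u x * multiplier (rieszSymbol 2) v x -
        multiplier (rieszSymbol 2) u x * multiplier (rieszSymbol 1) v x := by
    ext x; simp only [q12, pd_invGrad]
  have hs : q12Symbol = fun k l => rieszSymbol 1 k * rieszSymbol 2 l -
      rieszSymbol 2 k * rieszSymbol 1 l := by
    ext k l
    simp only [q12Symbol, rieszSymbol]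
    push_cast
    rw [div_eq_mul_inv, mul_inv]
    ring
  rw [hq, hs]
  exact key

theorem q0_schwartz (σ₁ σ₂ : ℤˣ) (j : Fin 2) (u v : 𝓢(SpaceTime, ℂ)) :
    Integrable (q0 σ₁ σ₂ j u v) ∧
      ft (q0 σ₁ σ₂ j u v) = bilinHat (q0Symbol σ₁ σ₂ j) (ft u) (ft v) := by
  have hm := measurable_rieszSymbol j.succ
  have h1 := norm_rieszSymbol_le j
  have key := nullForm_ft (measurable_dtSymbol_mul_inv σ₁) hm hm (measurable_dtSymbol_mul_inv σ₂)
    (norm_dtSymbol_mul_inv_le σ₁) h1 h1 (norm_dtSymbol_mul_inv_le σ₂) u v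
  have hq : q0 σ₁ σ₂ j u v = fun x =>
      multiplier (fun p => dtSymbol σ₁ p * ((spNorm p)⁻¹ : ℂ)) u x *
        multiplier (rieszSymbol j.succ) v x -
      multiplier (rieszSymbol j.succ) u x *
        multiplier (fun p => dtSymbol σ₂ p * ((spNorm p)⁻¹ : ℂ)) v x := by
    ext x; simp only [q0, pd_invGrad, dtInvGrad]
  have hs : q0Symbol σ₁ σ₂ j = fun k l =>
      dtSymbol σ₁ k * ((spNorm k)⁻¹ : ℂ) * rieszSymbol j.succ l -
      rieszSymbol j.succ k * (dtSymbol σ₂ l * ((spNorm l)⁻¹ : ℂ)) := by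
    ext k l
    simp only [q0Symbol, rieszSymbol]
    push_cast
    rw [div_eq_mul_inv, mul_inv]
    ring
  rw [hq, hs]
  exact key

end NullForms

end

/-! ### The null form estimates -/

open NullForms in
theorem lemma3p1 (r : ℝ) (hr1 : 1 < r) (hr2 : r ≤ 2) (α₁ α₂ b : ℝ)
    (hα₁ : 0 ≤ α₁) (hα₂ : 0 ≤ α₂) (hα : 1 / r ≤ α₁ + α₂) (hb : 1 / r < b) :
    ∃ C : ℝ≥0, ∀ σ₁ σ₂ : ℤˣ,
      -- the estimates for Schwartz functions, which are dense in the spaces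
      (∀ u v : 𝓢(SpaceTime, ℂ),
        (Integrable (q12 u v) volume ∧
          ft (q12 u v) = bilinHat q12Symbol (ft u) (ft v) ∧
          hNorm r 0 0 (q12 u v) ≤ C * xNorm r α₁ b σ₁ u * xNorm r α₂ b σ₂ v) ∧
        (∀ j : Fin 2, Integrable (q0 σ₁ σ₂ j u v) volume ∧
          ft (q0 σ₁ σ₂ j u v) = bilinHat (q0Symbol σ₁ σ₂ j) (ft u) (ft v) ∧
          hNorm r 0 0 (q0 σ₁ σ₂ j u v) ≤ C * xNorm r α₁ b σ₁ u * xNorm r α₂ b σ₂ v)) ∧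
      -- the estimates on the whole spaces, whose elements are given by their Fourier transforms
      (∀ F G : SpaceTime → ℂ, MemXHat r α₁ b σ₁ F → MemXHat r α₂ b σ₂ G →
        ((∀ᵐ p, Integrable (bilinIntegrand q12Symbol F G p) volume) ∧
          hHatNorm r 0 0 (bilinHat q12Symbol F G)
            ≤ C * xHatNorm r α₁ b σ₁ F * xHatNorm r α₂ b σ₂ G) ∧
        (∀ j : Fin 2,
          (∀ᵐ p, Integrable (bilinIntegrand (q0Symbol σ₁ σ₂ j) F G p) volume) ∧
          hHatNorm r 0 0 (bilinHat (q0Symbol σ₁ σ₂ j) F G)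
            ≤ C * xHatNorm r α₁ b σ₁ F * xHatNorm r α₂ b σ₂ G)) := by
  obtain ⟨C, hC⟩ := exists_bilinHat_bound hr1 hr2 hα₁ hα₂ hα hb
  refine ⟨C, fun σ₁ σ₂ => ?_⟩
  have hκ : sgn σ₁ * sgn σ₂ = 1 ∨ sgn σ₁ * sgn σ₂ = -1 := by
    rcases sgn_eq σ₁ with h | h <;> rcases sgn_eq σ₂ with h' | h' <;> simp [h, h']
  have h12 := hC σ₁ σ₂ q12Symbol measurable_q12Symbol (norm_q12Symbol_sq_le hκ)
  have h0 := fun j => hC σ₁ σ₂ (q0Symbol σ₁ σ₂ j) (measurable_q0Symbol σ₁ σ₂ j)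
    (norm_q0Symbol_sq_le σ₁ σ₂ j)
  have hft := fun u : 𝓢(SpaceTime, ℂ) =>
    (continuous_ft u).aestronglyMeasurable (μ := (volume : Measure SpaceTime))
  refine ⟨fun u v => ⟨?_, fun j => ?_⟩, fun F G hF hG => ?_⟩
  · obtain ⟨hi, he⟩ := q12_schwartz u v
    refine ⟨hi, he, ?_⟩
    rw [hNorm, he]
    exact (h12 _ _ (hft u) (hft v)).2
  · obtain ⟨hi, he⟩ := q0_schwartz σ₁ σ₂ j u v
    refine ⟨hi, he, ?_⟩
    rw [hNorm, he]
    exact (h0 j _ _ (hft u) (hft v)).2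
  · have hFm := aestronglyMeasurable_of_xWeight_mul hF.1
    have hGm := aestronglyMeasurable_of_xWeight_mul hG.1
    exact ⟨⟨(h12 F G hFm hGm).1 hF.2 hG.2, (h12 F G hFm hGm).2⟩,
      fun j => ⟨(h0 j F G hFm hGm).1 hF.2 hG.2, (h0 j F G hFm hGm).2⟩⟩
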